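/- Fix a non-negative radial $\varphi\in C^\infty(\mathbb R^3)$ supported in $\{3/4\le|\xi|\le 8/3\}$ with $\sum_{j\in\mathbb Z}\varphi(2^{-j}\xi)=1$ for $\xi\ne0$ and such that $\chi:=1-\sum_{j\ge0}\varphi(2^{-j}\cdot)$ belongs to $C_c^\infty(B(0,4/3))$. Let $\dot\Delta_j=\varphi(2^{-j}D)$ be the corresponding homogeneous Littlewood–Paley projectors. For $1\le p,r<\infty$ and $s<3/p$ let $\dot B^s_{p,r}(\mathbb R^3)$ be the space of tempered distributions $f$ with $$\|f\|_{\dot B^s_{p,r}}:=\Big(\sum_{j\in\mathbb Z}\big(2^{js}\|\dot\Delta_jf\|_{L^p}\big)^r\Big)^{1/r}<\infty$$ and $\sum_{j\in\mathbb Z}\dot\Delta_jf=f$ in the sense of tempered distributions. For $\alpha<3/2$ let $\|f\|_{\dot H^\alpha}=\||D|^\alpha f\|_{L^2}$ be the norm of the homogeneous Sobolev space $\dot H^\alpha(\mathbb R^3)$. Let $q>3$ and $s\in(-1+\frac2q,0)$. Then there exist $p,\delta,\hat\alpha$, depending only on $q$ and $s$, with $$\max(q,4)<p<\infty,\qquad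 \delta\in\Big(0,1-\frac3p\Big),\qquad \hat\alpha\in\Big(0,\frac32\Big),$$ such that the following holds. For every vector field $u_0\in\dot B^s_{q,q}(\mathbb R^3)\cap L^2(\mathbb R^3)$ with values in $\mathbb R^3$ and $\operatorname{div}u_0=0$ in the sense of distributions, and for every $\varepsilon>0$, there exist weakly divergence-free vector fields $$\bar u^{1,\varepsilon}\in\dot B^{-1+\frac3p+\delta}_{p,p}(\mathbb R^3)\cap L^2(\mathbb R^3),\qquad \bar u^{2,\varepsilon}\in\dot H^{\hat\alpha}(\mathbb R^3)\cap L^2(\mathbb R^3)$$ with values in $\mathbb R^3$ such that $u_0=\bar u^{1,\varepsilon}+\bar u^{2,\varepsilon}$, $$\|\bar u^{1,\varepsilon}\|_{\dot B^{-1+\frac3p+\delta}_{p,p}}^p\le\varepsilon^{p-q}\,\|u_0\|_{\dot B^s_{q,q}}^q,$$ $$\|\bar u^{2,\varepsilon}\|_{\dot H^{\hat\alpha}}^2\le C_1\,\varepsilon^{2-q}\,\|u_0\|_{\dot B^s_{q,q}}^q,$$ $$\|\bar u^{1,\varepsilon}\|_{L^2}\le C_0\|u_0\|_{L^2},\qquad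 \|\bar u^{2,\varepsilon}\|_{L^2}\le C_0\|u_0\|_{L^2}.$$ Here $C_1$ depends only on $s,q,p,\delta,\hat\alpha$ and $\|\mathcal F^{-1}\varphi\|_{L^1}$, and $C_0$ depends only on $\|\mathcal F^{-1}\varphi\|_{L^1}$; in particular neither depends on $u_0$ or $\varepsilon$. -/

import Mathlib

open MeasureTheory FourierTransform
open scoped SchwartzMap ENNReal ContDiff

noncomputable section

/-- Physical (and frequency) space `ℝ³` with its Euclidean norm. -/
abbrev R3 : Type := EuclideanSpace ℝ (Fin 3)

/-- The complexification `ℂ³` of the space of values, with its Hermitian norm. -/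
abbrev C3 : Type := EuclideanSpace ℂ (Fin 3)

/-- The inclusion `ℝ³ ⊆ ℂ³`, coordinate by coordinate. -/
def complexify : R3 →L[ℝ] C3 :=
  LinearMap.toContinuousLinearMap
    { toFun := fun x => WithLp.toLp 2 (fun i => (x i : ℂ))
      map_add' := fun x y => by ext i; simp
      map_smul' := fun c x => by ext i; simp }

/-- An `L²` vector field on `ℝ³` with values in `ℝ³`. -/
abbrev L2Field : Type := Lp R3 2 (volume : Measure R3)

/-- The tempered distribution `ψ ↦ ∫ ψ u` given by an `L²` vector field `u`. (Mathlib's tempered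
distributions have complex values, so the values of `u` are regarded as elements of `ℂ³`.) -/
def L2Field.toDist (u : L2Field) : 𝓢'(R3, C3) :=
  Lp.toTemperedDistribution (complexify.compLp u)

/-- `div u = 0` in the sense of distributions: `∫ u · ∇ψ = 0` for every real test function `ψ`;
here `u x · ∇ψ x` is written as the derivative of `ψ` at `x` in the direction `u x`. -/
def IsWeaklyDivFree (u : R3 → R3) : Prop :=
  ∀ ψ : R3 → ℝ, ContDiff ℝ ∞ ψ → HasCompactSupport ψ → ∫ x, fderiv ℝ ψ x (u x) = 0

/-- The tempered distribution `T` is (integration against) the function `f`. -/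
def IsRepresentedBy (T : 𝓢'(R3, C3)) (f : R3 → C3) : Prop :=
  ∀ ψ : 𝓢(R3, ℂ), Integrable (fun x => ψ x • f x) volume ∧ T ψ = ∫ x, ψ x • f x

/-- The `L^p` norm, `1 ≤ p`, of a tempered distribution; it is `∞` if the distribution is not a
function. (The representing function is unique almost everywhere, so the infimum is over at most
one value.) -/
def distLpNorm (p : ℝ≥0∞) (T : 𝓢'(R3, C3)) : ℝ≥0∞ :=
  ⨅ (f : R3 → C3) (_ : IsRepresentedBy T f), eLpNorm f p volume

/-- `φ` is the function of a dyadic (Littlewood-Paley) partition of unity on `ℝ³`: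
a non-negative radial smooth function supported in `{3/4 ≤ |ξ| ≤ 8/3}` whose dyadic dilations sum
to `1` away from the origin, and for which there is a companion `χ ∈ C_c^∞(B(0, 4/3))` with
`χ + ∑_{j ≥ 0} φ(2^{-j} ·) = 1`. -/
structure IsLittlewoodPaley (φ : R3 → ℝ) : Prop where
  contDiff : ContDiff ℝ ∞ φ
  nonneg : ∀ ξ, 0 ≤ φ ξ
  radial : ∀ ξ η, ‖ξ‖ = ‖η‖ → φ ξ = φ η
  tsupport_subset : tsupport φ ⊆ {ξ | 3 / 4 ≤ ‖ξ‖ ∧ ‖ξ‖ ≤ 8 / 3}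
  hasSum : ∀ ξ, ξ ≠ 0 → HasSum (fun j : ℤ => φ ((2 : ℝ) ^ (-j) • ξ)) 1
  exists_low : ∃ χ : R3 → ℝ, ContDiff ℝ ∞ χ ∧ HasCompactSupport χ ∧
    tsupport χ ⊆ Metric.ball 0 (4 / 3) ∧
    ∀ ξ, HasSum (fun j : ℕ => φ ((2 : ℝ) ^ (-(j : ℤ)) • ξ)) (1 - χ ξ)

/-- `‖𝓕⁻¹ φ‖_{L¹}`. This number is the same for the Fourier transform with kernel `e^{-i x·ξ}` and
for Mathlib's, with kernel `e^{-2π i x·ξ}`. -/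
def invFourierL1Norm (φ : R3 → ℝ) : ℝ :=
  ∫ x : R3, ‖𝓕⁻ (fun ξ : R3 => (φ ξ : ℂ)) x‖

/-- The homogeneous Littlewood-Paley projector `Δ̇_j = φ(2^{-j} D)`, `D = -i∇`. The factor `2π`
is there because Mathlib's Fourier variable `ξ` is the angular frequency divided by `2π`. -/
def dyadicBlock (φ : R3 → ℝ) (j : ℤ) : 𝓢'(R3, C3) →L[ℂ] 𝓢'(R3, C3) :=
  TemperedDistribution.fourierMultiplierCLM C3
    (fun ξ : R3 => (φ ((2 : ℝ) ^ (-j) • ((2 * Real.pi) • ξ)) : ℂ))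

/-- The norm of the homogeneous Besov space `Ḃ^s_{p,r}(ℝ³)`, `1 ≤ p, r < ∞`:
`(∑_{j ∈ ℤ} (2^{js} ‖Δ̇_j T‖_{L^p})^r)^{1/r}`, possibly `∞`. -/
def besovNorm (φ : R3 → ℝ) (s p r : ℝ) (T : 𝓢'(R3, C3)) : ℝ≥0∞ :=
  (∑' j : ℤ, (ENNReal.ofReal ((2 : ℝ) ^ ((j : ℝ) * s)) *
    distLpNorm (ENNReal.ofReal p) (dyadicBlock φ j T)) ^ r) ^ (1 / r)

/-- `T ∈ Ḃ^s_{p,r}(ℝ³)`, for `1 ≤ p, r < ∞` and `s < 3/p`: the norm is finite and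
`∑_{j ∈ ℤ} Δ̇_j T` converges to `T` as tempered distributions. -/
def MemBesov (φ : R3 → ℝ) (s p r : ℝ) (T : 𝓢'(R3, C3)) : Prop :=
  besovNorm φ s p r T < ⊤ ∧ HasSum (fun j : ℤ => dyadicBlock φ j T) T

/-- The norm of the homogeneous Sobolev space `Ḣ^α(ℝ³)`, `α < 3/2`: if the Fourier transform of
`T` is a function `g`, it is the `L²` norm of `|D|^α T`, which is the square root of
`∫ |2πξ|^{2α} |g(ξ)|² dξ`; it is `∞` if there is no such `g`. -/
def homSobolevNorm (α : ℝ) (T : 𝓢'(R3, C3)) : ℝ≥0∞ :=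
  ⨅ (g : R3 → C3) (_ : IsRepresentedBy (𝓕 T) g),
    (∫⁻ ξ : R3, ‖(2 * Real.pi) • ξ‖ₑ ^ (2 * α) * ‖g ξ‖ₑ ^ (2 : ℝ)) ^ (1 / 2 : ℝ)

/-- `T ∈ Ḣ^α(ℝ³)`, for `α < 3/2`. -/
def MemHomSobolev (α : ℝ) (T : 𝓢'(R3, C3)) : Prop :=
  homSobolevNorm α T < ⊤

end

/-!
The idea is real interpolation by truncation of the Littlewood-Paley blocks. The blocks
`f_k = Δ̇_k u₀` are real fields in `L² ∩ L^q`. Each is cut at the height `λ_k = c ε 2^{kθ}` into a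
part `g_k` of amplitude at most `λ_k` and a remainder `h_k`, so that
`‖g_k‖_p^p ≤ λ_k^{p-q} ‖f_k‖_q^q` and `‖h_k‖_2^2 ≤ λ_k^{2-q} ‖f_k‖_q^q` (`eLpNorm_lowPart_le`,
`enorm_highPart_sq_le`). The exponents are chosen (`exists_splitting_exponents`) such that these
powers of `λ_k` turn the weights of `Ḃ^{-1+3/p+δ}_{p,p}` and of `Ḣ^α` into those of `Ḃ^s_{q,q}`.

Truncation destroys both the localization in frequency and the divergence condition. Both are
restored by the Helmholtz-Leray projection localized to the `k`-th dyadic shell, a Fourier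
multiplier `P_k` whose symbol is a fixed matrix-valued bump function, dilated by `2^k`. The fields
are `u₁ = ∑ P_k g_k` and `u₂ = ∑ P_k h_k`. Their sum is `∑ P_k f_k = u₀` because `u₀` is
divergence-free, that is, its Fourier transform is orthogonal to the frequency
(`isWeaklyDivFree_iff`). On the Fourier side the sums are finite at every frequency
(`assemble`), which gives the `L²` and `Ḣ^α` bounds by near-orthogonality
(`lintegral_assemble_le`). For the Besov bound (`IsLittlewoodPaley.besovNorm_assemble_rpow_le`)
one needs that `Δ̇_j` and `P_k` are bounded on `L^p` by the `L¹` norms of their kernels. That is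
Young's inequality, once such a multiplier is known to be the convolution with its kernel on `L²`
(`fourierMultiplier_ae_eq_convolution`); the `L¹` norms do not depend on the dyadic scale
(`lintegral_fourierInv_comp_smul`). The factor `c` in `λ_k` makes the constant in the Besov
bound equal to `1`.

The fields `u₁` and `u₂` are real because their Fourier transforms have Hermitian symmetry, which
all the multipliers involved preserve (`IsHermitian.isRealField`).
-/

noncomputable section

/-! ### Fourier multipliers on `Lᵖ` -/

/-- Young's inequality `L¹ * Lᵖ ⊆ Lᵖ` for non-negative functions. -/
theorem lintegral_conv_rpow_le {G : Type*} [AddCommGroup G] [MeasurableSpace G]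
    [MeasurableAdd₂ G] [MeasurableNeg G] (μ : Measure G) [SFinite μ] [μ.IsAddRightInvariant]
    {k f : G → ℝ≥0∞} (hk : Measurable k) (hf : Measurable f) {p : ℝ} (hp : 1 < p) :
    ∫⁻ x, (∫⁻ y, k y * f (x - y) ∂μ) ^ p ∂μ ≤ (∫⁻ x, k x ∂μ) ^ p * ∫⁻ x, f x ^ p ∂μ := by
  have hp0 : 0 < p := by linarith
  obtain ⟨r, hpr⟩ : ∃ r : ℝ, r.HolderConjugate p := ⟨_, (Real.HolderConjugate.conjExponent hp).symm⟩
  have hr0 : 0 < r := hpr.pos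
  have hexp : 1 / r * p = p - 1 := by
    have h1 := hpr.inv_add_inv_eq_one
    field_simp at h1 ⊢
    linarith
  -- Hölder's inequality for the splitting `k f = k^{1/r} (k^{1/p} f)`
  have key : ∀ x, (∫⁻ y, k y * f (x - y) ∂μ) ^ p ≤
      (∫⁻ y, k y ∂μ) ^ (p - 1) * ∫⁻ y, k y * f (x - y) ^ p ∂μ := by
    intro x
    have h := ENNReal.lintegral_mul_le_Lp_mul_Lq μ hpr (f := fun y => k y ^ (1 / r))
      (g := fun y => k y ^ (1 / p) * f (x - y)) (by fun_prop) (by fun_prop)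
    have e1 : ∀ y, ((fun y => k y ^ (1 / r)) * fun y => k y ^ (1 / p) * f (x - y)) y
        = k y * f (x - y) := by
      intro y
      simp only [Pi.mul_apply, ← mul_assoc]
      rw [← ENNReal.rpow_add_of_nonneg _ _ (by positivity) (by positivity)]
      have : 1 / r + 1 / p = 1 := by simpa using hpr.inv_add_inv_eq_one
      rw [this, ENNReal.rpow_one]
    have e2 : ∀ y, (k y ^ (1 / r)) ^ r = k y := by
      intro y
      rw [← ENNReal.rpow_mul, one_div_mul_cancel hr0.ne', ENNReal.rpow_one]
    have e3 : ∀ y, (k y ^ (1 / p) * f (x - y)) ^ p = k y * f (x - y) ^ p := by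
      intro y
      rw [ENNReal.mul_rpow_of_nonneg _ _ hp0.le, ← ENNReal.rpow_mul,
        one_div_mul_cancel hp0.ne', ENNReal.rpow_one]
    simp only [e1, e2, e3] at h
    calc _ ≤ ((∫⁻ y, k y ∂μ) ^ (1 / r) * (∫⁻ y, k y * f (x - y) ^ p ∂μ) ^ (1 / p)) ^ p := by
            gcongr
      _ = _ := by
        rw [ENNReal.mul_rpow_of_nonneg _ _ hp0.le, ← ENNReal.rpow_mul, ← ENNReal.rpow_mul,
          one_div_mul_cancel hp0.ne', ENNReal.rpow_one, hexp]
  calc _ ≤ ∫⁻ x, (∫⁻ y, k y ∂μ) ^ (p - 1) * ∫⁻ y, k y * f (x - y) ^ p ∂μ ∂μ :=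
        lintegral_mono key
    _ = (∫⁻ y, k y ∂μ) ^ (p - 1) * ∫⁻ x, ∫⁻ y, k y * f (x - y) ^ p ∂μ ∂μ := by
        rw [lintegral_const_mul]
        exact Measurable.lintegral_prod_right' (f := fun z : G × G => k z.2 * f (z.1 - z.2) ^ p)
          (by fun_prop)
    _ = (∫⁻ y, k y ∂μ) ^ (p - 1) * ∫⁻ y, k y * ∫⁻ x, f x ^ p ∂μ ∂μ := by
        rw [lintegral_lintegral_swap (by fun_prop)]
        congr 1
        refine lintegral_congr fun y => ?_
        rw [lintegral_const_mul _ (by fun_prop)]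
        congr 1
        exact lintegral_sub_right_eq_self (fun x => f x ^ p) y
    _ = _ := by
        rw [lintegral_mul_const _ hk, ← mul_assoc]
        congr 1
        conv_rhs => rw [show p = (p - 1) + 1 by ring,
          ENNReal.rpow_add_of_nonneg _ _ (by linarith) zero_le_one, ENNReal.rpow_one]

theorem fourier_sub {V W : Type*} [AddCommGroup V] [AddCommGroup W] [FourierTransform V W]
    [FourierAdd V W] (f g : V) : 𝓕 (f - g) = 𝓕 f - 𝓕 g :=
  map_sub (AddMonoidHom.mk' 𝓕 FourierTransform.fourier_add) f g

section Kernel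

variable {E F₁ F₂ F₃ : Type*} [NormedAddCommGroup E] [InnerProductSpace ℝ E]
  [FiniteDimensional ℝ E] [MeasurableSpace E] [BorelSpace E]
  [NormedAddCommGroup F₁] [NormedSpace ℂ F₁]
  [NormedAddCommGroup F₂] [InnerProductSpace ℂ F₂]
  [NormedAddCommGroup F₃] [InnerProductSpace ℂ F₃]

open Convolution

/-- The Cauchy-Schwarz inequality for a convolution at a point. -/
theorem norm_convolution_le_eLpNorm_two (B : F₁ →L[ℂ] F₂ →L[ℂ] F₃) {K : E → F₁} {v : E → F₂}
    (hK : MemLp K 2) (hv : MemLp v 2) (x : E) :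
    ‖(K ⋆[B] v) x‖ₑ ≤ ‖B‖ₑ * eLpNorm K 2 * eLpNorm v 2 := by
  have hmp : MeasurePreserving (fun y : E => x - y) := Measure.measurePreserving_sub_left volume x
  have h := eLpNorm_le_eLpNorm_mul_eLpNorm_of_nnnorm (μ := (volume : Measure E)) (p := 2) (q := 2)
    (r := 1) hK.1 (hv.1.comp_measurePreserving hmp) (fun a b => B a b) ‖B‖₊
    (Filter.Eventually.of_forall fun y => by exact B.le_opNorm₂ _ _)
  rw [eLpNorm_comp_measurePreserving hv.1 hmp] at h
  calc _ ≤ ∫⁻ y, ‖B (K y) (v (x - y))‖ₑ := enorm_integral_le_lintegral_enorm _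
    _ = eLpNorm (fun y => B (K y) ((v ∘ fun y => x - y) y)) 1 volume := by
      rw [eLpNorm_one_eq_lintegral_enorm]; rfl
    _ ≤ _ := h

theorem convolutionExistsAt_of_memLp_two (B : F₁ →L[ℂ] F₂ →L[ℂ] F₃) {K : E → F₁} {v : E → F₂}
    (hK : MemLp K 2) (hv : MemLp v 2) (x : E) : ConvolutionExistsAt K v x B volume := by
  have hmp : MeasurePreserving (fun y : E => x - y) := Measure.measurePreserving_sub_left volume x
  have := MemLp.of_bilin (r := 1) (fun a b => B a b) ‖B‖₊ hK (hv.comp_measurePreserving hmp)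
    (B.aestronglyMeasurable_comp₂ hK.1 (hv.1.comp_measurePreserving hmp))
    (Filter.Eventually.of_forall fun y => by exact B.le_opNorm₂ _ _)
  rw [memLp_one_iff_integrable] at this
  exact this

variable [CompleteSpace F₁] [CompleteSpace F₂] [CompleteSpace F₃]

/-- In `L²`, a Fourier multiplier with Schwartz symbol is the convolution with its kernel. -/
theorem fourierMultiplier_ae_eq_convolution (B : F₁ →L[ℂ] F₂ →L[ℂ] F₃) (m : 𝓢(E, F₁))
    (v : Lp F₂ 2 (volume : Measure E)) (w : Lp F₃ 2 (volume : Measure E))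
    (hw : ∀ᵐ ξ, (𝓕 w : Lp F₃ 2 (volume : Measure E)) ξ =
      B (m ξ) ((𝓕 v : Lp F₂ 2 (volume : Measure E)) ξ)) :
    w =ᵐ[volume] (⇑(𝓕⁻ m : 𝓢(E, F₁)) ⋆[B] v) := by
  -- for Schwartz functions the claim is the convolution theorem; approximate `v` by such `V n`
  obtain ⟨V, hV⟩ : ∃ V : ℕ → 𝓢(E, F₂),
      Filter.Tendsto (fun n => (V n).toLp 2 volume) Filter.atTop (nhds v) := by
    have hd := SchwartzMap.denseRange_toLpCLM (E := E) (F := F₂) (μ := volume) (p := 2)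
      ENNReal.ofNat_ne_top v
    obtain ⟨x, hx, hx'⟩ := mem_closure_iff_seq_limit.1 hd
    choose V hV using hx
    refine ⟨V, ?_⟩
    convert! hx' using 2 with n
    exact hV n
  set W : ℕ → 𝓢(E, F₃) := fun n => SchwartzMap.convolution B (𝓕⁻ m) (V n) with hW
  have hWF : ∀ n ξ, (𝓕 (W n)) ξ = B (m ξ) ((𝓕 (V n)) ξ) := by
    intro n ξ
    rw [hW, SchwartzMap.fourier_convolution]
    simp
  have hWapp : ∀ n x, W n x = (⇑(𝓕⁻ m : 𝓢(E, F₁)) ⋆[B] (V n)) x := by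
    intro n x
    rw [hW, SchwartzMap.convolution_apply]
  obtain ⟨M, hM⟩ : ∃ M : ℝ, ∀ ξ, ‖m ξ‖ ≤ M :=
    ⟨_, fun ξ => SchwartzMap.norm_le_seminorm ℝ m ξ⟩
  have hWlim : Filter.Tendsto (fun n => (W n).toLp 2 volume) Filter.atTop (nhds w) := by
    rw [tendsto_iff_norm_sub_tendsto_zero] at hV ⊢
    have h1 : ∀ n, ‖(W n).toLp 2 volume - w‖ ≤ (‖B‖ * M) * ‖(V n).toLp 2 volume - v‖ := by
      intro n
      rw [← Lp.norm_fourier_eq, ← Lp.norm_fourier_eq ((V n).toLp 2 volume - v)]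
      apply Lp.norm_le_mul_norm_of_ae_le_mul
      rw [fourier_sub, fourier_sub, SchwartzMap.toLp_fourier_eq,
        SchwartzMap.toLp_fourier_eq]
      filter_upwards [Lp.coeFn_sub ((𝓕 (W n)).toLp 2 volume) (𝓕 w),
        Lp.coeFn_sub ((𝓕 (V n)).toLp 2 volume) (𝓕 v), (𝓕 (W n)).coeFn_toLp 2 volume,
        (𝓕 (V n)).coeFn_toLp 2 volume, hw] with ξ h1 h2 h3 h4 h5
      rw [h1, h2, Pi.sub_apply, Pi.sub_apply, h3, h4, h5, hWF, ← map_sub]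
      refine (B.le_opNorm₂ _ _).trans ?_
      gcongr
      exact hM ξ
    refine squeeze_zero (fun n => norm_nonneg _) h1 ?_
    simpa using hV.const_mul (‖B‖ * M)
  obtain ⟨ns, hns, hae⟩ := (tendstoInMeasure_of_tendsto_Lp hWlim).exists_seq_tendsto_ae
  have hK : MemLp ⇑(𝓕⁻ m : 𝓢(E, F₁)) 2 (volume : Measure E) := (𝓕⁻ m : 𝓢(E, F₁)).memLp 2 volume
  -- the convolutions converge even pointwise, by the Cauchy-Schwarz inequality
  have hpt : ∀ x, Filter.Tendsto (fun n => W n x) Filter.atTop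
      (nhds ((⇑(𝓕⁻ m : 𝓢(E, F₁)) ⋆[B] v) x)) := by
    intro x
    rw [tendsto_iff_edist_tendsto_0]
    have hb : ∀ n, edist (W n x) ((⇑(𝓕⁻ m : 𝓢(E, F₁)) ⋆[B] v) x) ≤
        ‖B‖ₑ * eLpNorm (𝓕⁻ m : 𝓢(E, F₁)) 2 volume * edist ((V n).toLp 2 volume) v := by
      intro n
      rw [hWapp, edist_eq_enorm_sub]
      have e := convolutionExistsAt_of_memLp_two B hK ((V n).memLp 2 volume) x
      have e' := convolutionExistsAt_of_memLp_two B hK (Lp.memLp v) x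
      have : (⇑(𝓕⁻ m : 𝓢(E, F₁)) ⋆[B] (V n)) x - (⇑(𝓕⁻ m : 𝓢(E, F₁)) ⋆[B] v) x =
          (⇑(𝓕⁻ m : 𝓢(E, F₁)) ⋆[B] (⇑(V n) - ⇑v)) x := by
        rw [convolution_def, convolution_def, convolution_def, ← integral_sub e e']
        simp
      rw [this]
      refine (norm_convolution_le_eLpNorm_two B hK (((V n).memLp 2 volume).sub (Lp.memLp v))
        x).trans ?_
      rw [Lp.edist_def]
      gcongr
      refine (eLpNorm_congr_ae ?_).le
      filter_upwards [(V n).coeFn_toLp 2 volume] with y hy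
      simp [hy]
    refine tendsto_of_tendsto_of_tendsto_of_le_of_le tendsto_const_nhds ?_ (fun _ => zero_le)
      hb
    have h0 := (tendsto_iff_edist_tendsto_0.1 hV)
    have hfin : ‖B‖ₑ * eLpNorm (𝓕⁻ m : 𝓢(E, F₁)) 2 (volume : Measure E) ≠ ⊤ :=
      ENNReal.mul_ne_top enorm_ne_top hK.2.ne
    simpa using ENNReal.Tendsto.const_mul h0 (Or.inr hfin)
  have hall : ∀ᵐ x, ∀ n, (W n).toLp 2 (volume : Measure E) x = W n x := by
    rw [ae_all_iff]
    exact fun n => (W n).coeFn_toLp 2 volume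
  filter_upwards [hae, hall] with x hx hx'
  refine tendsto_nhds_unique hx ?_
  simp only [hx']
  exact (hpt x).comp hns.tendsto_atTop

/-- A Fourier multiplier whose symbol `m` is a Schwartz function is bounded on `Lᵖ`, with constant
`‖𝓕⁻¹ m‖_{L¹}`; the multiplier is applied to functions which are also in `L²`. -/
theorem eLpNorm_fourierMultiplier_le (B : F₁ →L[ℂ] F₂ →L[ℂ] F₃) (hB : ‖B‖ ≤ 1) (m : 𝓢(E, F₁))
    (v : Lp F₂ 2 (volume : Measure E)) (w : Lp F₃ 2 (volume : Measure E))
    (hw : ∀ᵐ ξ, (𝓕 w : Lp F₃ 2 (volume : Measure E)) ξ =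
      B (m ξ) ((𝓕 v : Lp F₂ 2 (volume : Measure E)) ξ)) {p : ℝ} (hp : 1 < p) :
    eLpNorm w (ENNReal.ofReal p) volume ≤
      (∫⁻ x, ‖𝓕⁻ (m : E → F₁) x‖ₑ) * eLpNorm v (ENNReal.ofReal p) volume := by
  have hp0 : 0 < p := by linarith
  have hne : ENNReal.ofReal p ≠ 0 := by simpa using hp0
  rw [eLpNorm_congr_ae (fourierMultiplier_ae_eq_convolution B m v w hw),
    eLpNorm_eq_lintegral_rpow_enorm_toReal hne ENNReal.ofReal_ne_top,
    eLpNorm_eq_lintegral_rpow_enorm_toReal hne ENNReal.ofReal_ne_top, ENNReal.toReal_ofReal hp0.le,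
    one_div, ← ENNReal.rpow_le_rpow_iff hp0, ENNReal.mul_rpow_of_nonneg _ _ hp0.le,
    ENNReal.rpow_inv_rpow hp0.ne', ENNReal.rpow_inv_rpow hp0.ne']
  borelize F₁
  have h1 : Measurable fun x => ‖(𝓕⁻ m : 𝓢(E, F₁)) x‖ₑ := (𝓕⁻ m : 𝓢(E, F₁)).continuous.enorm.measurable
  have h2 : Measurable fun x => ‖v x‖ₑ := (Lp.stronglyMeasurable v).enorm
  refine le_trans (lintegral_mono fun x => ?_) ((lintegral_conv_rpow_le volume h1 h2 hp).trans
    (le_of_eq ?_))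
  · gcongr
    refine (enorm_integral_le_lintegral_enorm _).trans (lintegral_mono fun y => ?_)
    have h3 := B.le_of_opNorm₂_le_of_le hB (le_refl ‖(𝓕⁻ m : 𝓢(E, F₁)) y‖) (le_refl ‖v (x - y)‖)
    rw [one_mul] at h3
    rw [← ofReal_norm, ← ofReal_norm, ← ofReal_norm, ← ENNReal.ofReal_mul (norm_nonneg _)]
    exact ENNReal.ofReal_le_ofReal h3
  · rw [SchwartzMap.fourierInv_coe]

end Kernel

/-- The `L¹` norm of the inverse Fourier transform is invariant under dilations. -/
theorem lintegral_fourierInv_comp_smul {F : Type*} [NormedAddCommGroup F] [NormedSpace ℂ F]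
    (m : R3 → F) {c : ℝ} (hc : 0 < c) :
    ∫⁻ x, ‖𝓕⁻ (fun ξ => m (c • ξ)) x‖ₑ = ∫⁻ x, ‖𝓕⁻ m x‖ₑ := by
  have h1 : ∀ x, 𝓕⁻ (fun ξ => m (c • ξ)) x = (c ^ 3)⁻¹ • 𝓕⁻ m (c⁻¹ • x) := by
    intro x
    rw [Real.fourierInv_eq, Real.fourierInv_eq]
    have := Measure.integral_comp_smul (volume : Measure R3)
      (fun ξ => Real.fourierChar (inner ℝ ξ (c⁻¹ • x)) • m ξ) c
    simp only [finrank_euclideanSpace, Fintype.card_fin] at this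
    rw [abs_of_pos (by positivity)] at this
    rw [← this]
    congr with ξ
    rw [inner_smul_left, inner_smul_right]
    simp [hc.ne']
  simp only [h1]
  have h2 : ∀ x : R3, ‖(c ^ 3)⁻¹ • 𝓕⁻ m (c⁻¹ • x)‖ₑ =
      ENNReal.ofReal (c ^ 3)⁻¹ * ‖𝓕⁻ m (c⁻¹ • x)‖ₑ := by
    intro x
    rw [enorm_smul, Real.enorm_eq_ofReal (by positivity)]
  simp only [h2]
  rw [lintegral_const_mul' _ _ ENNReal.ofReal_ne_top]
  have h3 := (Homeomorph.smulOfNeZero c⁻¹ (inv_ne_zero hc.ne')).measurableEmbedding.lintegral_map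
    (μ := (volume : Measure R3)) (fun x => ‖𝓕⁻ m x‖ₑ)
  simp only [Homeomorph.smulOfNeZero_apply] at h3
  rw [← h3]
  have h4 := Measure.map_addHaar_smul (volume : Measure R3) (inv_ne_zero hc.ne')
  rw [h4]
  simp only [finrank_euclideanSpace, Fintype.card_fin]
  rw [lintegral_smul_measure, smul_eq_mul, ← mul_assoc, ← ENNReal.ofReal_mul (by positivity),
    abs_of_pos (by positivity)]
  have : (c ^ 3)⁻¹ * ((c⁻¹) ^ 3)⁻¹ = 1 := by field_simp
  rw [this]; simp

/-! ### Dyadic dilations -/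

/-- Square-integrable fields on `ℝ³` with values in `ℂ³`. -/
abbrev C3Field : Type := Lp C3 2 (volume : Measure R3)

/-- The dilate `φ(2^{-j} ·)`, as a function of Mathlib's Fourier variable `ξ`, which is the angular
frequency divided by `2π`. For real `φ` it is the symbol of `Δ̇_j`. -/
def dyadicSymbol {F : Type*} (φ : R3 → F) (j : ℤ) (ξ : R3) : F :=
  φ ((2 : ℝ) ^ (-j) • ((2 * Real.pi) • ξ))

theorem dyadicSymbol_eq_smul {F : Type*} (φ : R3 → F) (j : ℤ) :
    dyadicSymbol φ j = fun ξ => φ (((2 : ℝ) ^ (-j) * (2 * Real.pi)) • ξ) := by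
  ext ξ
  rw [dyadicSymbol, smul_smul]

theorem dyadicScale_pos (j : ℤ) : 0 < (2 : ℝ) ^ (-j) * (2 * Real.pi) := by positivity

theorem HasCompactSupport.dyadicSymbol {F : Type*} [Zero F] {φ : R3 → F}
    (h : HasCompactSupport φ) (j : ℤ) : HasCompactSupport (dyadicSymbol φ j) := by
  rw [dyadicSymbol_eq_smul]
  exact h.comp_homeomorph (Homeomorph.smulOfNeZero _ (dyadicScale_pos j).ne')

theorem ContDiff.dyadicSymbol {F : Type*} [NormedAddCommGroup F] [NormedSpace ℝ F] {φ : R3 → F}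
    (h : ContDiff ℝ ∞ φ) (j : ℤ) : ContDiff ℝ ∞ (dyadicSymbol φ j) := by
  rw [dyadicSymbol_eq_smul]
  exact h.comp (contDiff_const_smul _)

/-! ### Fields as tempered distributions -/

theorem integrable_schwartz_smul (ψ : 𝓢(R3, ℂ)) (v : C3Field) :
    Integrable (fun x => ψ x • v x) volume :=
  memLp_one_iff_integrable.1 ((Lp.memLp v).smul (ψ.memLp 2 volume))

theorem isRepresentedBy_toTemperedDistribution (v : C3Field) :
    IsRepresentedBy (Lp.toTemperedDistribution v) v := fun ψ =>
  ⟨integrable_schwartz_smul ψ v, Lp.toTemperedDistribution_apply v ψ⟩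

/-- A real test function, as a complex Schwartz function. -/
def realTestFunction {g : R3 → ℝ} (hg : ContDiff ℝ ∞ g) (hc : HasCompactSupport g) : 𝓢(R3, ℂ) :=
  HasCompactSupport.toSchwartzMap (f := fun x => (g x : ℂ)) (hc.comp_left (g := Complex.ofReal) rfl)
    (Complex.ofRealCLM.contDiff.comp hg)

@[simp] theorem realTestFunction_apply {g : R3 → ℝ} (hg : ContDiff ℝ ∞ g)
    (hc : HasCompactSupport g) (x : R3) : realTestFunction hg hc x = g x := rfl

theorem IsRepresentedBy.locallyIntegrable {T : 𝓢'(R3, C3)} {f : R3 → C3}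
    (h : IsRepresentedBy T f) : LocallyIntegrable f volume := by
  intro x
  -- test with a bump function which is `1` near `x`
  let b : ContDiffBump x := ⟨1, 2, one_pos, one_lt_two⟩
  refine ⟨Metric.closedBall x 1, Metric.closedBall_mem_nhds x one_pos, ?_⟩
  have h1 := ((h (realTestFunction b.contDiff b.hasCompactSupport)).1).integrableOn
    (s := Metric.closedBall x 1)
  refine h1.congr_fun (fun y hy => ?_) Metric.isClosed_closedBall.measurableSet
  simp [b.one_of_mem_closedBall hy]

/-- The function representing a distribution is unique, so the infima in `distLpNorm` and
`homSobolevNorm` are over at most one value. -/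
theorem IsRepresentedBy.ae_eq {T : 𝓢'(R3, C3)} {f g : R3 → C3}
    (hf : IsRepresentedBy T f) (hg : IsRepresentedBy T g) : f =ᵐ[volume] g := by
  refine ae_eq_of_integral_contDiff_smul_eq hf.locallyIntegrable hg.locallyIntegrable
    fun η hη hc => ?_
  have h := (hf (realTestFunction hη hc)).2.symm.trans (hg (realTestFunction hη hc)).2
  simpa using h

theorem distLpNorm_toTemperedDistribution (p : ℝ≥0∞) (v : C3Field) :
    distLpNorm p (Lp.toTemperedDistribution v) = eLpNorm v p volume := by
  refine le_antisymm (iInf₂_le _ (isRepresentedBy_toTemperedDistribution v)) ?_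
  refine le_iInf₂ fun f hf => ?_
  exact (eLpNorm_congr_ae ((isRepresentedBy_toTemperedDistribution v).ae_eq hf)).le

theorem homSobolevNorm_toTemperedDistribution_le (α : ℝ) (v : C3Field) :
    homSobolevNorm α (Lp.toTemperedDistribution v) ≤
      (∫⁻ ξ : R3, ‖(2 * Real.pi) • ξ‖ₑ ^ (2 * α) * ‖(𝓕 v : C3Field) ξ‖ₑ ^ (2 : ℝ)) ^
        (1 / 2 : ℝ) := by
  refine iInf₂_le _ ?_
  rw [Lp.fourier_toTemperedDistribution_eq]
  exact isRepresentedBy_toTemperedDistribution _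

/-- On `L²`, a Fourier multiplier on tempered distributions multiplies the Fourier transform. -/
theorem fourierMultiplierCLM_apply_eq_integral {m : R3 → ℂ} (hm : m.HasTemperateGrowth)
    (v : C3Field) (η : 𝓢(R3, ℂ)) :
    TemperedDistribution.fourierMultiplierCLM C3 m (Lp.toTemperedDistribution v) η =
      ∫ ξ, (m ξ * (𝓕⁻ η : 𝓢(R3, ℂ)) ξ) • (𝓕 v : C3Field) ξ := by
  rw [TemperedDistribution.fourierMultiplierCLM_apply_apply,
    ← TemperedDistribution.fourier_apply, Lp.fourier_toTemperedDistribution_eq,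
    Lp.toTemperedDistribution_apply]
  simp [SchwartzMap.smulLeftCLM_apply_apply hm]

theorem toTemperedDistribution_apply_eq_integral_fourier (v : C3Field) (η : 𝓢(R3, ℂ)) :
    Lp.toTemperedDistribution v η = ∫ ξ, (𝓕⁻ η : 𝓢(R3, ℂ)) ξ • (𝓕 v : C3Field) ξ := by
  rw [← Lp.toTemperedDistribution_apply, ← Lp.fourier_toTemperedDistribution_eq,
    TemperedDistribution.fourier_apply, FourierTransform.fourier_fourierInv_eq]

theorem fourierMultiplierCLM_toTemperedDistribution {m : R3 → ℂ} (hm : m.HasTemperateGrowth)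
    {v w : C3Field} (h : ∀ᵐ ξ, (𝓕 w : C3Field) ξ = m ξ • (𝓕 v : C3Field) ξ) :
    TemperedDistribution.fourierMultiplierCLM C3 m (Lp.toTemperedDistribution v) =
      Lp.toTemperedDistribution w := by
  ext1 η
  rw [fourierMultiplierCLM_apply_eq_integral hm, toTemperedDistribution_apply_eq_integral_fourier]
  refine integral_congr_ae ?_
  filter_upwards [h] with ξ hξ
  rw [hξ, smul_smul, mul_comm]

/-! ### The dyadic blocks of a field -/

namespace IsLittlewoodPaley

variable {φ : R3 → ℝ} (hφ : IsLittlewoodPaley φ)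
include hφ

theorem hasCompactSupport : HasCompactSupport φ := by
  refine (isCompact_closedBall (0 : R3) (8 / 3)).of_isClosed_subset (isClosed_tsupport φ) ?_
  exact fun ξ hξ => by simpa using (hφ.tsupport_subset hξ).2

theorem eq_zero {ξ : R3} (h : ¬ (3 / 4 ≤ ‖ξ‖ ∧ ‖ξ‖ ≤ 8 / 3)) : φ ξ = 0 := by
  by_contra h0
  exact h (hφ.tsupport_subset (subset_tsupport φ h0))

theorem hasSum_dyadicSymbol {ξ : R3} (hξ : ξ ≠ 0) :
    HasSum (fun j : ℤ => dyadicSymbol φ j ξ) 1 :=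
  hφ.hasSum _ (smul_ne_zero (by positivity) hξ)

theorem dyadicSymbol_nonneg (j : ℤ) (ξ : R3) : 0 ≤ dyadicSymbol φ j ξ := hφ.nonneg _

theorem dyadicSymbol_le_one (j : ℤ) (ξ : R3) : dyadicSymbol φ j ξ ≤ 1 := by
  by_cases hξ : ξ = 0
  · have : dyadicSymbol φ j ξ = 0 := hφ.eq_zero (by simp [hξ])
    simp [this]
  · exact le_hasSum (hφ.hasSum_dyadicSymbol hξ) j fun i _ => hφ.dyadicSymbol_nonneg i ξ

/-- The symbol of the block `Δ̇_j` as a Schwartz function. -/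
def schwartzSymbol (j : ℤ) : 𝓢(R3, ℂ) :=
  realTestFunction (hφ.contDiff.dyadicSymbol j) (hφ.hasCompactSupport.dyadicSymbol j)

@[simp] theorem schwartzSymbol_apply (j : ℤ) (ξ : R3) :
    hφ.schwartzSymbol j ξ = ((dyadicSymbol φ j ξ : ℝ) : ℂ) := rfl

theorem hasTemperateGrowth (j : ℤ) :
    (fun ξ : R3 => ((dyadicSymbol φ j ξ : ℝ) : ℂ)).HasTemperateGrowth :=
  (hφ.schwartzSymbol j).hasTemperateGrowth

theorem dyadicBlock_toTemperedDistribution {j : ℤ} {v w : C3Field}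
    (h : ∀ᵐ ξ, (𝓕 w : C3Field) ξ = ((dyadicSymbol φ j ξ : ℝ) : ℂ) • (𝓕 v : C3Field) ξ) :
    dyadicBlock φ j (Lp.toTemperedDistribution v) = Lp.toTemperedDistribution w :=
  fourierMultiplierCLM_toTemperedDistribution (hφ.hasTemperateGrowth j) h

/-- The kernel of `Δ̇_j` has the same `L¹` norm as `𝓕⁻¹ φ`. -/
theorem lintegral_fourierInv_schwartzSymbol (j : ℤ) :
    ∫⁻ x, ‖𝓕⁻ (hφ.schwartzSymbol j : R3 → ℂ) x‖ₑ = ENNReal.ofReal (invFourierL1Norm φ) := by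
  have h1 : (hφ.schwartzSymbol j : R3 → ℂ) =
      fun ξ => (fun η => (φ η : ℂ)) (((2 : ℝ) ^ (-j) * (2 * Real.pi)) • ξ) := by
    ext ξ
    rw [schwartzSymbol_apply, dyadicSymbol_eq_smul]
  rw [h1, lintegral_fourierInv_comp_smul (fun η => (φ η : ℂ)) (dyadicScale_pos j), invFourierL1Norm,
    ofReal_integral_norm_eq_lintegral_enorm]
  have h2 := (𝓕⁻ (realTestFunction hφ.contDiff hφ.hasCompactSupport) : 𝓢(R3, ℂ)).integrable
    (μ := volume)
  rwa [SchwartzMap.fourierInv_coe] at h2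

/-- `Δ̇_j` is bounded on `Lᵖ` with norm at most `‖𝓕⁻¹ φ‖_{L¹}`. -/
theorem eLpNorm_dyadicBlock_le {j : ℤ} {v w : C3Field}
    (h : ∀ᵐ ξ, (𝓕 w : C3Field) ξ = ((dyadicSymbol φ j ξ : ℝ) : ℂ) • (𝓕 v : C3Field) ξ)
    {p : ℝ} (hp : 1 < p) :
    eLpNorm w (ENNReal.ofReal p) volume ≤
      ENNReal.ofReal (invFourierL1Norm φ) * eLpNorm v (ENNReal.ofReal p) volume := by
  rw [← hφ.lintegral_fourierInv_schwartzSymbol j]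
  exact eLpNorm_fourierMultiplier_le (ContinuousLinearMap.lsmul ℂ ℂ)
    ContinuousLinearMap.opNorm_lsmul_le (hφ.schwartzSymbol j) v w h hp

/-- The Littlewood-Paley decomposition of an `L²` field converges to the field, because the
Fourier transforms against a test function converge by the partition of unity. -/
theorem hasSum_dyadicBlock (v : C3Field) :
    HasSum (fun j : ℤ => dyadicBlock φ j (Lp.toTemperedDistribution v))
      (Lp.toTemperedDistribution v) := by
  refine PointwiseConvergenceCLM.tendsto_iff_forall_tendsto.2 fun η => ?_
  set F : R3 → C3 := fun ξ => (𝓕⁻ η : 𝓢(R3, ℂ)) ξ • (𝓕 v : C3Field) ξ with hF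
  have hFi : Integrable F := integrable_schwartz_smul _ _
  have hterm : ∀ j, dyadicBlock φ j (Lp.toTemperedDistribution v) η =
      ∫ ξ, ((dyadicSymbol φ j ξ : ℝ) : ℂ) • F ξ := by
    intro j
    refine (fourierMultiplierCLM_apply_eq_integral (hφ.hasTemperateGrowth j) v η).trans ?_
    simp only [hF, smul_smul]
  have hne : ∀ᵐ ξ : R3, ξ ≠ 0 := by
    exact compl_mem_ae_iff.2 (measure_singleton (0 : R3))
  have hcont : ∀ j, Continuous fun ξ => ((dyadicSymbol φ j ξ : ℝ) : ℂ) := fun j =>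
    (hφ.schwartzSymbol j).continuous
  have hint : ∀ j, Integrable (fun ξ => ((dyadicSymbol φ j ξ : ℝ) : ℂ) • F ξ) := fun j => by
    refine hFi.bdd_smul 1 (hcont j).aestronglyMeasurable (Filter.Eventually.of_forall fun ξ => ?_)
    simpa [abs_of_nonneg (hφ.dyadicSymbol_nonneg j ξ)] using hφ.dyadicSymbol_le_one j ξ
  have hsum : Summable fun j => ∫ ξ, ‖((dyadicSymbol φ j ξ : ℝ) : ℂ) • F ξ‖ := by
    have hfin : ∑' j, ∫⁻ ξ, ‖((dyadicSymbol φ j ξ : ℝ) : ℂ) • F ξ‖ₑ ≠ ⊤ := by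
      rw [← lintegral_tsum fun j => (hint j).1.enorm]
      refine ne_of_lt (lt_of_le_of_lt (lintegral_mono_ae ?_) hFi.2)
      filter_upwards [hne] with ξ hξ
      have h1 : ∀ j, ‖((dyadicSymbol φ j ξ : ℝ) : ℂ) • F ξ‖ₑ =
          ENNReal.ofReal (dyadicSymbol φ j ξ) * ‖F ξ‖ₑ := by
        intro j
        rw [enorm_smul, ← ofReal_norm, Complex.norm_real, Real.norm_of_nonneg
          (hφ.dyadicSymbol_nonneg j ξ)]
      simp only [h1]
      rw [ENNReal.tsum_mul_right, ← ENNReal.ofReal_tsum_of_nonneg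
        (fun j => hφ.dyadicSymbol_nonneg j ξ) (hφ.hasSum_dyadicSymbol hξ).summable,
        (hφ.hasSum_dyadicSymbol hξ).tsum_eq]
      simp
    have := ENNReal.summable_toReal hfin
    refine this.congr fun j => ?_
    rw [integral_norm_eq_lintegral_enorm (hint j).1]
  have hmain := hasSum_integral_of_summable_integral_norm hint hsum
  have hval : ∫ ξ, ∑' j, ((dyadicSymbol φ j ξ : ℝ) : ℂ) • F ξ = ∫ ξ, F ξ := by
    refine integral_congr_ae ?_
    filter_upwards [hne] with ξ hξ
    have h1 : HasSum (fun j => ((dyadicSymbol φ j ξ : ℝ) : ℂ)) 1 := by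
      exact_mod_cast Complex.ofRealCLM.hasSum (hφ.hasSum_dyadicSymbol hξ)
    rw [(h1.smul_const (F ξ)).tsum_eq, one_smul]
  rw [hval] at hmain
  rw [toTemperedDistribution_apply_eq_integral_fourier]
  have hmain' : Filter.Tendsto (fun s : Finset ℤ => ∑ j ∈ s,
      ∫ ξ, ((dyadicSymbol φ j ξ : ℝ) : ℂ) • F ξ) Filter.atTop (nhds (∫ ξ, F ξ)) := hmain
  refine hmain'.congr fun s => ?_
  rw [sum_apply]
  exact Finset.sum_congr rfl fun j _ => (hterm j).symm

end IsLittlewoodPaley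

/-! ### Real fields and Hermitian symmetry of the Fourier transform -/

/-- Complex conjugation on `ℂ³`, coordinate by coordinate. -/
def conjC3 : C3 →L[ℝ] C3 :=
  LinearMap.toContinuousLinearMap
    { toFun := fun x => WithLp.toLp 2 (fun i => (starRingEnd ℂ) (x i))
      map_add' := fun x y => by ext i; simp
      map_smul' := fun c x => by ext i; simp }

@[simp] theorem conjC3_apply (x : C3) (i : Fin 3) : conjC3 x i = (starRingEnd ℂ) (x i) := rfl

@[simp] theorem complexify_apply (x : R3) (i : Fin 3) : complexify x i = (x i : ℂ) := rfl

@[simp] theorem conjC3_conjC3 (x : C3) : conjC3 (conjC3 x) = x := by ext i; simp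

theorem conjC3_smul (c : ℂ) (x : C3) : conjC3 (c • x) = (starRingEnd ℂ) c • conjC3 x := by
  ext i; simp

@[simp] theorem conjC3_complexify (x : R3) : conjC3 (complexify x) = complexify x := by
  ext i; simp

@[simp] theorem norm_complexify (x : R3) : ‖complexify x‖ = ‖x‖ := by
  simp [EuclideanSpace.norm_eq]

/-- The real part of a vector of `ℂ³`. -/
def rePart : C3 →L[ℝ] R3 :=
  LinearMap.toContinuousLinearMap
    { toFun := fun x => WithLp.toLp 2 (fun i => (x i).re)
      map_add' := fun x y => by ext i; simp
      map_smul' := fun c x => by ext i; simp }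

@[simp] theorem rePart_apply (x : C3) (i : Fin 3) : rePart x i = (x i).re := rfl

theorem complexify_rePart {x : C3} (hx : conjC3 x = x) : complexify (rePart x) = x := by
  ext i
  have := congrArg (fun z : C3 => z i) hx
  simpa using Complex.conj_eq_iff_re.1 this

/-- The field takes values in `ℝ³ ⊆ ℂ³`, almost everywhere. -/
def IsRealField (v : R3 → C3) : Prop := ∀ᵐ x, conjC3 (v x) = v x

/-- The symmetry which characterizes the Fourier transforms of real fields. -/
def IsHermitian (G : R3 → C3) : Prop := ∀ᵐ ξ, G (-ξ) = conjC3 (G ξ)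

theorem isRealField_complexify (u : L2Field) : IsRealField (complexify.compLp u) := by
  filter_upwards [complexify.coeFn_compLp u] with x hx
  rw [hx, conjC3_complexify]

theorem exists_complexify_eq {v : C3Field} (hv : IsRealField v) :
    ∃ u : L2Field, complexify.compLp u = v := by
  refine ⟨rePart.compLp v, ?_⟩
  ext1
  filter_upwards [complexify.coeFn_compLp (rePart.compLp v), rePart.coeFn_compLp v, hv]
    with x h1 h2 h3
  rw [h1, h2, complexify_rePart h3]

theorem ae_comp_neg {P : R3 → Prop} (h : ∀ᵐ ξ, P ξ) : ∀ᵐ ξ, P (-ξ) :=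
  (Measure.measurePreserving_neg (volume : Measure R3)).quasiMeasurePreserving.ae h

theorem fourier_conjC3_schwartz (f : 𝓢(R3, C3)) (ξ : R3) :
    𝓕 (fun x => conjC3 (f x)) ξ = conjC3 ((𝓕 f : 𝓢(R3, C3)) (-ξ)) := by
  rw [SchwartzMap.fourier_coe, Real.fourier_eq, Real.fourier_eq]
  rw [← ContinuousLinearMap.integral_comp_comm]
  · refine integral_congr_ae (Filter.Eventually.of_forall fun x => ?_)
    simp only [Circle.smul_def, conjC3_smul, inner_neg_right, neg_neg]
    congr 1
    rw [← Circle.coe_inv_eq_conj, ← AddChar.map_neg_eq_inv]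
  · exact (Real.fourierIntegral_convergent_iff (-ξ)).2 (f.integrable (μ := volume))

/-- Conjugating an `L²` field conjugates and reflects its Fourier transform. -/
theorem fourier_conjC3 (v : C3Field) :
    ∀ᵐ ξ, (𝓕 (conjC3.compLp v : C3Field) : C3Field) ξ = conjC3 ((𝓕 v : C3Field) (-ξ)) := by
  have hneg := Measure.measurePreserving_neg (volume : Measure R3)
  set Z : C3Field → C3Field := fun v =>
    Lp.compMeasurePreserving (fun ξ => -ξ) hneg (conjC3.compLp (𝓕 v)) with hZ
  have hZc : Continuous Z := by
    have h1 : Continuous (Lp.compMeasurePreservingₗᵢ ℝ (E := C3) (p := 2)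
      (fun ξ : R3 => -ξ) hneg) := LinearIsometry.continuous _
    have h2 : Continuous (conjC3.compLpL 2 (volume : Measure R3)) := ContinuousLinearMap.continuous _
    have h3 : Continuous (𝓕 : C3Field → C3Field) := FourierTransform.continuous_fourier
    exact h1.comp (h2.comp h3)
  have hZv : ∀ v : C3Field, Z v =ᵐ[volume] fun ξ => conjC3 ((𝓕 v : C3Field) (-ξ)) := by
    intro v
    filter_upwards [Lp.coeFn_compMeasurePreserving (conjC3.compLp (𝓕 v : C3Field)) hneg,
      ae_comp_neg (conjC3.coeFn_compLp (𝓕 v : C3Field))] with ξ h1 h2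
    rw [hZ, h1, Function.comp_apply, h2]
  have key : 𝓕 (conjC3.compLp v : C3Field) = Z v := by
    refine DenseRange.induction_on (p := fun v => 𝓕 (conjC3.compLp v : C3Field) = Z v)
      (SchwartzMap.denseRange_toLpCLM (E := R3) (F := C3) (μ := volume) (p := 2)
        ENNReal.ofNat_ne_top) v (isClosed_eq ?_ hZc) fun f => ?_
    · have h2 : Continuous (conjC3.compLpL 2 (volume : Measure R3)) :=
        ContinuousLinearMap.continuous _
      have h3 : Continuous (𝓕 : C3Field → C3Field) := FourierTransform.continuous_fourier
      exact h3.comp h2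
    · set g : 𝓢(R3, C3) := SchwartzMap.postcompCLM conjC3 f with hg
      have e1 : (conjC3.compLp (f.toLp 2 volume) : C3Field) = g.toLp 2 volume := by
        ext1
        filter_upwards [conjC3.coeFn_compLp (f.toLp 2 volume), f.coeFn_toLp 2 volume,
          g.coeFn_toLp 2 volume] with x h1 h2 h3
        rw [h1, h2, h3, hg, SchwartzMap.postcompCLM_apply]
      change 𝓕 (conjC3.compLp (f.toLp 2 volume) : C3Field) = Z (f.toLp 2 volume)
      rw [e1, SchwartzMap.toLp_fourier_eq]
      ext1
      refine Filter.EventuallyEq.trans ?_ (hZv _).symm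
      rw [SchwartzMap.toLp_fourier_eq]
      filter_upwards [(𝓕 g).coeFn_toLp 2 volume, ae_comp_neg ((𝓕 f).coeFn_toLp 2 volume)]
        with ξ h1 h2
      rw [h1, h2, ← fourier_conjC3_schwartz]
      rfl
  rw [key]
  exact hZv v

theorem IsRealField.isHermitian_fourier {v : C3Field} (hv : IsRealField v) :
    IsHermitian (𝓕 v : C3Field) := by
  have h : (conjC3.compLp v : C3Field) = v := by
    ext1
    filter_upwards [conjC3.coeFn_compLp v, hv] with x h1 h2
    rw [h1, h2]
  have h1 := fourier_conjC3 v
  rw [h] at h1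
  filter_upwards [h1] with ξ hξ
  rw [hξ, conjC3_conjC3]

theorem IsHermitian.isRealField {v : C3Field} (hv : IsHermitian (𝓕 v : C3Field)) :
    IsRealField v := by
  have h : (conjC3.compLp v : C3Field) = v := by
    apply (Lp.fourierTransformₗᵢ R3 C3).injective
    change 𝓕 (conjC3.compLp v : C3Field) = 𝓕 v
    ext1
    filter_upwards [fourier_conjC3 v, hv] with ξ h1 h2
    rw [h1, h2, conjC3_conjC3]
  have h1 := conjC3.coeFn_compLp v
  rw [h] at h1
  filter_upwards [h1] with x hx using hx.symm

/-! ### Divergence-free fields on the Fourier side -/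

open LineDeriv

theorem inner_complexify (ξ : R3) (z : C3) :
    inner ℂ (complexify ξ) z = ∑ i : Fin 3, (ξ i : ℂ) * z i := by
  simp [PiLp.inner_apply, mul_comm]

/-- The Schwartz function `ξᵢ η`. -/
def coordMul (i : Fin 3) (η : 𝓢(R3, ℂ)) : 𝓢(R3, ℂ) :=
  SchwartzMap.smulLeftCLM ℂ (inner ℝ · (EuclideanSpace.single i (1 : ℝ))) η

theorem coordMul_apply (i : Fin 3) (η : 𝓢(R3, ℂ)) (ξ : R3) :
    coordMul i η ξ = (ξ i : ℂ) * η ξ := by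
  rw [coordMul, SchwartzMap.smulLeftCLM_apply_apply (by fun_prop)]
  simp [EuclideanSpace.inner_single_right]

theorem schwartz_mul_inner_eq (η : 𝓢(R3, ℂ)) (v : C3Field) (ξ : R3) :
    η ξ * inner ℂ (complexify ξ) (v ξ) = ∑ i : Fin 3, (coordMul i η ξ • v ξ) i := by
  rw [inner_complexify, Finset.mul_sum]
  refine Finset.sum_congr rfl fun i _ => ?_
  rw [coordMul_apply]
  simp
  ring

theorem integrable_coord {f : R3 → C3} (hf : Integrable f) (i : Fin 3) :
    Integrable fun x => f x i :=
  (EuclideanSpace.proj (𝕜 := ℂ) i : C3 →L[ℂ] ℂ).integrable_comp hf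

theorem integral_coord {f : R3 → C3} (hf : Integrable f) (i : Fin 3) :
    (∫ x, f x) i = ∫ x, f x i :=
  ((EuclideanSpace.proj (𝕜 := ℂ) i : C3 →L[ℂ] ℂ).integral_comp_comm hf).symm

theorem integrable_schwartz_mul_inner (η : 𝓢(R3, ℂ)) (v : C3Field) :
    Integrable fun ξ => η ξ * inner ℂ (complexify ξ) (v ξ) := by
  simp only [schwartz_mul_inner_eq]
  exact integrable_finsetSum _ fun i _ => integrable_coord (integrable_schwartz_smul _ _) i

/-- The distributional divergence of an `L²` field, computed on the Fourier side. -/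
theorem sum_lineDeriv_apply (v : C3Field) (ψ : 𝓢(R3, ℂ)) :
    ∑ i : Fin 3, (Lp.toTemperedDistribution v (∂_{EuclideanSpace.single i (1 : ℝ)} ψ)) i =
      -(2 * Real.pi * Complex.I) *
        ∫ ξ, (𝓕⁻ ψ : 𝓢(R3, ℂ)) ξ * inner ℂ (complexify ξ) ((𝓕 v : C3Field) ξ) := by
  simp only [schwartz_mul_inner_eq]
  rw [integral_finsetSum _ fun i _ => integrable_coord (integrable_schwartz_smul _ _) i,
    Finset.mul_sum]
  refine Finset.sum_congr rfl fun i _ => ?_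
  rw [toTemperedDistribution_apply_eq_integral_fourier, SchwartzMap.fourierInv_lineDerivOp_eq,
    integral_coord (integrable_schwartz_smul _ _), ← integral_const_mul]
  refine integral_congr_ae (Filter.Eventually.of_forall fun ξ => ?_)
  simp [coordMul]
  ring

theorem sum_coord_mul_lineDeriv (ψ : 𝓢(R3, ℂ)) (x y : R3) :
    fderiv ℝ ψ x y = ∑ i : Fin 3, ((∂_{EuclideanSpace.single i (1 : ℝ)} ψ) x • complexify y) i := by
  conv_lhs => rw [← (EuclideanSpace.basisFun (Fin 3) ℝ).sum_repr y]
  rw [map_sum]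
  refine Finset.sum_congr rfl fun i _ => ?_
  simp [SchwartzMap.lineDerivOp_apply_eq_fderiv, mul_comm]

theorem toDist_apply (u : L2Field) (ψ : 𝓢(R3, ℂ)) :
    u.toDist ψ = ∫ x, ψ x • complexify (u x) := by
  rw [L2Field.toDist, Lp.toTemperedDistribution_apply]
  refine integral_congr_ae ?_
  filter_upwards [complexify.coeFn_compLp u] with x hx
  rw [hx]

theorem integrable_schwartz_smul_complexify (u : L2Field) (ψ : 𝓢(R3, ℂ)) :
    Integrable fun x => ψ x • complexify (u x) := by
  refine (integrable_schwartz_smul ψ (complexify.compLp u)).congr ?_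
  filter_upwards [complexify.coeFn_compLp u] with x hx
  rw [hx]

theorem integrable_fderiv_schwartz (u : L2Field) (ψ : 𝓢(R3, ℂ)) :
    Integrable fun x => fderiv ℝ ψ x (u x) := by
  simp only [sum_coord_mul_lineDeriv]
  exact integrable_finsetSum _ fun i _ =>
    integrable_coord (integrable_schwartz_smul_complexify _ _) i

/-- The distributional divergence of a real field, tested against `ψ`. -/
theorem sum_lineDeriv_toDist (u : L2Field) (ψ : 𝓢(R3, ℂ)) :
    ∑ i : Fin 3, (u.toDist (∂_{EuclideanSpace.single i (1 : ℝ)} ψ)) i =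
      ∫ x, fderiv ℝ ψ x (u x) := by
  simp only [sum_coord_mul_lineDeriv]
  rw [integral_finsetSum _ fun i _ => integrable_coord (integrable_schwartz_smul_complexify _ _) i]
  refine Finset.sum_congr rfl fun i _ => ?_
  rw [toDist_apply, integral_coord (integrable_schwartz_smul_complexify _ _)]

/-- A weakly divergence-free field annihilates gradients of non-compactly supported functions, by
cutting them off at larger and larger scales. -/
theorem IsWeaklyDivFree.integral_fderiv_eq_zero {u : R3 → R3} (hu : IsWeaklyDivFree u)
    (hum : AEStronglyMeasurable u volume)
    {ρ : R3 → ℝ} (hρ : ContDiff ℝ ∞ ρ) (h1 : Integrable fun x => |ρ x| * ‖u x‖)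
    (h2 : Integrable fun x => fderiv ℝ ρ x (u x)) :
    ∫ x, fderiv ℝ ρ x (u x) = 0 := by
  let b : ContDiffBump (0 : R3) := ⟨1, 2, one_pos, one_lt_two⟩
  set χ : ℕ → R3 → ℝ := fun n x => b (((n : ℝ) + 1)⁻¹ • x) with hχ
  have hχs : ∀ n, ContDiff ℝ ∞ (χ n) := fun n => b.contDiff.comp (contDiff_const_smul _)
  have hχc : ∀ n, HasCompactSupport (χ n) := fun n =>
    b.hasCompactSupport.comp_homeomorph (Homeomorph.smulOfNeZero ((n : ℝ) + 1)⁻¹ (by positivity))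
  obtain ⟨M, hM⟩ : ∃ M, ∀ x, ‖fderiv ℝ b x‖ ≤ M := by
    obtain ⟨M, hM⟩ := (b.hasCompactSupport.fderiv (𝕜 := ℝ)).exists_bound_of_continuous
      ((b.contDiff (n := 1)).continuous_fderiv (by simp))
    exact ⟨M, hM⟩
  have hM0 : 0 ≤ M := (norm_nonneg _).trans (hM 0)
  have hder : ∀ n x, ‖fderiv ℝ (χ n) x‖ ≤ ((n : ℝ) + 1)⁻¹ * M := by
    intro n x
    have : fderiv ℝ (χ n) x = ((n : ℝ) + 1)⁻¹ • fderiv ℝ b (((n : ℝ) + 1)⁻¹ • x) :=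
      fderiv_comp_smul _
    rw [this, norm_smul, Real.norm_of_nonneg (by positivity)]
    gcongr
    exact hM _
  have hprod : ∀ n x, fderiv ℝ (fun x => χ n x * ρ x) x (u x) =
      χ n x * fderiv ℝ ρ x (u x) + ρ x * fderiv ℝ (χ n) x (u x) := by
    intro n x
    rw [fderiv_fun_mul ((hχs n).differentiable (by simp) x) (hρ.differentiable (by simp) x)]
    simp
  have hzero : ∀ n, ∫ x, fderiv ℝ (fun x => χ n x * ρ x) x (u x) = 0 := fun n =>
    hu _ ((hχs n).mul hρ) ((hχc n).mul_right)
  have hlim : Filter.Tendsto (fun n => ∫ x, fderiv ℝ (fun x => χ n x * ρ x) x (u x))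
      Filter.atTop (nhds (∫ x, fderiv ℝ ρ x (u x))) := by
    refine tendsto_integral_of_dominated_convergence
      (fun x => ‖fderiv ℝ ρ x (u x)‖ + M * (|ρ x| * ‖u x‖)) (fun n => ?_)
      (h2.norm.add (h1.const_mul M)) (fun n => ?_) ?_
    · have hc : Continuous (fderiv ℝ (fun x => χ n x * ρ x)) :=
        ((hχs n).mul hρ).continuous_fderiv (by simp)
      exact (ContinuousLinearMap.id ℝ (R3 →L[ℝ] ℝ)).aestronglyMeasurable_comp₂
        hc.aestronglyMeasurable hum
    · refine Filter.Eventually.of_forall fun x => ?_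
      rw [hprod]
      refine (norm_add_le _ _).trans (add_le_add ?_ ?_)
      · rw [norm_mul, Real.norm_of_nonneg b.nonneg]
        exact mul_le_of_le_one_left (norm_nonneg _) b.le_one
      · rw [norm_mul, Real.norm_eq_abs]
        have h3 : ‖fderiv ℝ (χ n) x (u x)‖ ≤ M * ‖u x‖ := by
          refine ((fderiv ℝ (χ n) x).le_opNorm _).trans ?_
          gcongr
          refine (hder n x).trans (mul_le_of_le_one_left hM0 ?_)
          exact inv_le_one_of_one_le₀ (by linarith [n.cast_nonneg (α := ℝ)])
        calc _ ≤ |ρ x| * (M * ‖u x‖) := by gcongr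
          _ = _ := by ring
    · refine Filter.Eventually.of_forall fun x => ?_
      simp only [hprod]
      have hinv : Filter.Tendsto (fun n : ℕ => ((n : ℝ) + 1)⁻¹) Filter.atTop (nhds 0) := by
        simpa using tendsto_one_div_add_atTop_nhds_zero_nat (𝕜 := ℝ)
      have t1 : Filter.Tendsto (fun n => χ n x) Filter.atTop (nhds 1) := by
        have h4 : Filter.Tendsto (fun n : ℕ => ((n : ℝ) + 1)⁻¹ • x) Filter.atTop (nhds 0) := by
          simpa using hinv.smul_const x
        have h5 : b 0 = 1 := b.one_of_mem_closedBall (by simp [b])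
        rw [← h5]
        exact (b.continuous.tendsto 0).comp h4
      have t2 : Filter.Tendsto (fun n => fderiv ℝ (χ n) x (u x)) Filter.atTop (nhds 0) := by
        refine squeeze_zero_norm (a := fun n : ℕ => ((n : ℝ) + 1)⁻¹ * M * ‖u x‖) (fun n => ?_) ?_
        · refine ((fderiv ℝ (χ n) x).le_opNorm _).trans ?_
          gcongr
          exact hder n x
        · simpa using (hinv.mul_const M).mul_const ‖u x‖
      simpa using (t1.mul_const (fderiv ℝ ρ x (u x))).add (t2.const_mul (ρ x))
  refine tendsto_nhds_unique hlim ?_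
  simp [hzero]

theorem IsWeaklyDivFree.integral_schwartz {u : L2Field} (hu : IsWeaklyDivFree u)
    (ψ : 𝓢(R3, ℂ)) : ∫ x, fderiv ℝ ψ x (u x) = 0 := by
  have key : ∀ L : ℂ →L[ℝ] ℝ, (∀ z, |L z| ≤ ‖z‖) → ∫ x, L (fderiv ℝ ψ x (u x)) = 0 := by
    intro L hL
    have hd : ∀ x, fderiv ℝ (fun x => L (ψ x)) x (u x) = L (fderiv ℝ ψ x (u x)) := by
      intro x
      rw [show (fun x => L (ψ x)) = L ∘ ψ from rfl,
        fderiv_comp _ L.differentiableAt ψ.differentiableAt]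
      simp
    have := hu.integral_fderiv_eq_zero (Lp.aestronglyMeasurable u) (ρ := fun x => L (ψ x))
      (L.contDiff.comp (ψ.smooth ⊤)) ?_ ?_
    · simpa only [hd] using this
    · refine (integrable_schwartz_smul_complexify u ψ).norm.mono ?_ ?_
      · exact ((L.continuous.comp ψ.continuous).abs.aestronglyMeasurable).mul
          (Lp.aestronglyMeasurable u).norm
      · refine Filter.Eventually.of_forall fun x => ?_
        simp only [norm_mul, norm_smul, norm_complexify, Real.norm_eq_abs, abs_abs, abs_norm]
        exact mul_le_mul_of_nonneg_right (hL _) (norm_nonneg _)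
    · simp only [hd]
      exact L.integrable_comp (integrable_fderiv_schwartz u ψ)
  have hi := integrable_fderiv_schwartz u ψ
  apply Complex.ext
  · exact (Complex.reCLM.integral_comp_comm hi).symm.trans
      (key Complex.reCLM fun z => Complex.abs_re_le_norm z)
  · exact (Complex.imCLM.integral_comp_comm hi).symm.trans
      (key Complex.imCLM fun z => Complex.abs_im_le_norm z)

theorem locallyIntegrable_inner (v : C3Field) :
    LocallyIntegrable (fun ξ => inner ℂ (complexify ξ) (v ξ)) volume := by
  intro x
  let b : ContDiffBump x := ⟨1, 2, one_pos, one_lt_two⟩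
  refine ⟨Metric.closedBall x 1, Metric.closedBall_mem_nhds x one_pos, ?_⟩
  have h1 := (integrable_schwartz_mul_inner (realTestFunction b.contDiff b.hasCompactSupport)
    v).integrableOn (s := Metric.closedBall x 1)
  refine h1.congr_fun (fun y hy => ?_) Metric.isClosed_closedBall.measurableSet
  simp [b.one_of_mem_closedBall hy]

/-- A field is weakly divergence-free if and only if its Fourier transform is orthogonal to the
frequency. -/
theorem isWeaklyDivFree_iff (u : L2Field) : IsWeaklyDivFree u ↔
    ∀ᵐ ξ, inner ℂ (complexify ξ) ((𝓕 (complexify.compLp u : C3Field) : C3Field) ξ) = 0 := by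
  have hc : -(2 * Real.pi * Complex.I) ≠ 0 := by simp [Real.pi_ne_zero]
  have hdiv : ∀ ψ : 𝓢(R3, ℂ), ∫ x, fderiv ℝ ψ x (u x) = -(2 * Real.pi * Complex.I) *
      ∫ ξ, (𝓕⁻ ψ : 𝓢(R3, ℂ)) ξ * inner ℂ (complexify ξ)
        ((𝓕 (complexify.compLp u : C3Field) : C3Field) ξ) := fun ψ =>
    (sum_lineDeriv_toDist u ψ).symm.trans (sum_lineDeriv_apply _ ψ)
  constructor
  · intro hu
    refine ae_eq_zero_of_integral_contDiff_smul_eq_zero (locallyIntegrable_inner _)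
      fun g hg hgc => ?_
    have h := (hdiv (𝓕 (realTestFunction hg hgc))).symm.trans (hu.integral_schwartz _)
    rw [mul_eq_zero, FourierTransform.fourierInv_fourier_eq] at h
    simpa using h.resolve_left hc
  · intro h ψ hψ hψc
    have h1 := hdiv (realTestFunction hψ hψc)
    have h2 : ∫ ξ, (𝓕⁻ (realTestFunction hψ hψc) : 𝓢(R3, ℂ)) ξ * inner ℂ (complexify ξ)
        ((𝓕 (complexify.compLp u : C3Field) : C3Field) ξ) = 0 := by
      rw [integral_eq_zero_of_ae]
      filter_upwards [h] with ξ hξ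
      simp [hξ]
    rw [h2, mul_zero] at h1
    have h3 : ∀ x, fderiv ℝ (realTestFunction hψ hψc) x (u x) = (fderiv ℝ ψ x (u x) : ℝ) := by
      intro x
      have : (realTestFunction hψ hψc : R3 → ℂ) = Complex.ofRealCLM ∘ ψ := rfl
      rw [this, fderiv_comp _ Complex.ofRealCLM.differentiableAt
        (hψ.differentiable (by simp) x)]
      simp
    simp only [h3] at h1
    rw [integral_complex_ofReal] at h1
    exact_mod_cast h1

/-! ### The Helmholtz-Leray projection localized to dyadic shells -/

/-- A smooth radial function equal to `1` on `{3/4 ≤ |ξ| ≤ 8/3}` and supported in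
`{1/2 ≤ |ξ| ≤ 4}`. -/
def annulusBump (ξ : R3) : ℝ :=
  (⟨8 / 3, 4, by norm_num, by norm_num⟩ : ContDiffBump (0 : R3)) ξ -
    (⟨1 / 2, 3 / 4, by norm_num, by norm_num⟩ : ContDiffBump (0 : R3)) ξ

theorem contDiff_annulusBump : ContDiff ℝ ∞ annulusBump :=
  (ContDiffBump.contDiff _).sub (ContDiffBump.contDiff _)

theorem annulusBump_neg (ξ : R3) : annulusBump (-ξ) = annulusBump ξ := by
  simp [annulusBump, ContDiffBump.neg]

theorem annulusBump_eq_one {ξ : R3} (h : 3 / 4 ≤ ‖ξ‖) (h' : ‖ξ‖ ≤ 8 / 3) : annulusBump ξ = 1 := by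
  rw [annulusBump, ContDiffBump.one_of_mem_closedBall _ (by simpa using h'),
    ContDiffBump.zero_of_le_dist _ (by simpa using h), sub_zero]

theorem annulusBump_eq_zero_of_le {ξ : R3} (h : ‖ξ‖ ≤ 1 / 2) : annulusBump ξ = 0 := by
  rw [annulusBump, ContDiffBump.one_of_mem_closedBall _ (by simp; linarith),
    ContDiffBump.one_of_mem_closedBall _ (by simpa using h), sub_self]

theorem annulusBump_eq_zero_of_ge {ξ : R3} (h : 4 ≤ ‖ξ‖) : annulusBump ξ = 0 := by
  rw [annulusBump, ContDiffBump.zero_of_le_dist _ (by simpa using h),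
    ContDiffBump.zero_of_le_dist _ (by simp; linarith), sub_self]

theorem annulusBump_le_one (ξ : R3) : annulusBump ξ ≤ 1 := by
  rw [annulusBump]
  exact (sub_le_self _ (ContDiffBump.nonneg _)).trans (ContDiffBump.le_one _)

theorem annulusBump_nonneg (ξ : R3) : 0 ≤ annulusBump ξ := by
  rw [annulusBump, sub_nonneg]
  by_cases h : 3 / 4 ≤ ‖ξ‖
  · rw [ContDiffBump.zero_of_le_dist _ (by simpa using h)]
    exact ContDiffBump.nonneg _
  · rw [ContDiffBump.one_of_mem_closedBall ⟨8 / 3, 4, _, _⟩ (by simp; linarith)]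
    exact ContDiffBump.le_one _

/-- The endomorphism `z ↦ (ξ · z) ξ` of `ℂ³`. -/
def outerSquare (ξ : R3) : C3 →L[ℂ] C3 :=
  ∑ i : Fin 3, ∑ j : Fin 3, (ξ i * ξ j) •
    (EuclideanSpace.proj (𝕜 := ℂ) j : C3 →L[ℂ] ℂ).smulRight (EuclideanSpace.single i (1 : ℂ))

theorem outerSquare_apply (ξ : R3) (z : C3) :
    outerSquare ξ z = inner ℂ (complexify ξ) z • complexify ξ := by
  ext k
  rw [inner_complexify]
  simp [outerSquare, Fin.sum_univ_three]
  fin_cases k <;> simp <;> ring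

/-- The symbol `ψ(ξ) (I - ξ ⊗ ξ / |ξ|²)` of the Helmholtz-Leray projection localized to an annulus
by the bump function `ψ`. -/
def lerayBump (ξ : R3) : C3 →L[ℂ] C3 :=
  annulusBump ξ • (ContinuousLinearMap.id ℂ C3 - (‖ξ‖ ^ 2)⁻¹ • outerSquare ξ)

theorem lerayBump_apply (ξ : R3) (z : C3) : lerayBump ξ z =
    annulusBump ξ • (z - (‖ξ‖ ^ 2)⁻¹ • inner ℂ (complexify ξ) z • complexify ξ) := by
  simp [lerayBump, outerSquare_apply]

theorem contDiff_outerSquare : ContDiff ℝ ∞ outerSquare := by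
  unfold outerSquare
  have h : ∀ i : Fin 3, ContDiff ℝ ∞ fun ξ : R3 => ξ i := fun i => by fun_prop
  exact ContDiff.sum fun i _ => ContDiff.sum fun j _ => ((h i).mul (h j)).smul contDiff_const

theorem contDiff_lerayBump : ContDiff ℝ ∞ lerayBump := by
  rw [contDiff_iff_contDiffAt]
  intro ξ
  by_cases hξ : ξ = 0
  · have : lerayBump =ᶠ[nhds ξ] fun _ => 0 := by
      filter_upwards [Metric.ball_mem_nhds ξ (show (0 : ℝ) < 1 / 2 by norm_num)] with η hη
      subst hξ
      ext1 z
      rw [lerayBump_apply, annulusBump_eq_zero_of_le (by simpa using (Metric.mem_ball.1 hη).le),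
        zero_smul, zero_apply]
    exact contDiffAt_const.congr_of_eventuallyEq this
  · have h1 : ContDiffAt ℝ ∞ (fun η : R3 => (‖η‖ ^ 2)⁻¹) ξ :=
      (contDiff_norm_sq ℝ).contDiffAt.inv (by simpa using hξ)
    exact contDiff_annulusBump.contDiffAt.smul
      (contDiffAt_const.sub (h1.smul contDiff_outerSquare.contDiffAt))

theorem lerayBump_eq_zero {ξ : R3} (h : ¬ (1 / 2 ≤ ‖ξ‖ ∧ ‖ξ‖ ≤ 4)) : lerayBump ξ = 0 := by
  ext1 z
  rw [lerayBump_apply, zero_apply]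
  rw [not_and_or, not_le, not_le] at h
  rcases h with h | h
  · rw [annulusBump_eq_zero_of_le h.le, zero_smul]
  · rw [annulusBump_eq_zero_of_ge h.le, zero_smul]

theorem hasCompactSupport_lerayBump : HasCompactSupport lerayBump := by
  refine HasCompactSupport.intro (isCompact_closedBall (0 : R3) 4) fun ξ hξ => ?_
  exact lerayBump_eq_zero fun h => hξ (by simpa using h.2)

theorem inner_complexify_self (ξ : R3) :
    inner ℂ (complexify ξ) (complexify ξ) = ((‖ξ‖ ^ 2 : ℝ) : ℂ) := by
  rw [inner_self_eq_norm_sq_to_K, norm_complexify]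
  norm_cast

theorem inner_lerayBump (ξ : R3) (z : C3) : inner ℂ (complexify ξ) (lerayBump ξ z) = 0 := by
  by_cases hξ : ξ = 0
  · simp [hξ]
  have h : (‖ξ‖ : ℂ) ≠ 0 := by simpa using hξ
  rw [lerayBump_apply]
  simp only [← Complex.coe_smul, inner_smul_right, inner_sub_right, inner_complexify_self]
  push_cast
  field_simp
  simp

theorem norm_lerayBump_le (ξ : R3) (z : C3) : ‖lerayBump ξ z‖ ≤ ‖z‖ := by
  by_cases hξ : ξ = 0
  · rw [lerayBump_eq_zero (by simp [hξ])]
    simp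
  set a : C3 := (‖ξ‖ ^ 2)⁻¹ • inner ℂ (complexify ξ) z • complexify ξ with ha
  have h0 : (‖ξ‖ : ℂ) ≠ 0 := by simpa using hξ
  -- `z - a` is orthogonal to `a`
  have horth : inner ℂ (z - a) a = 0 := by
    rw [← inner_conj_symm, ha]
    simp only [← Complex.coe_smul, inner_smul_left, inner_smul_right, inner_sub_right,
      inner_complexify_self]
    push_cast
    field_simp
    simp
  have hle : ‖z - a‖ ≤ ‖z‖ := by
    have h2 := norm_add_sq_eq_norm_sq_add_norm_sq_of_inner_eq_zero (z - a) a horth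
    rw [sub_add_cancel] at h2
    nlinarith [norm_nonneg (z - a), norm_nonneg z, mul_self_nonneg ‖a‖]
  rw [lerayBump_apply, norm_smul, Real.norm_of_nonneg (annulusBump_nonneg ξ)]
  exact (mul_le_of_le_one_left (norm_nonneg _) (annulusBump_le_one ξ)).trans hle

theorem lerayBump_eq_self {ξ : R3} (h : 3 / 4 ≤ ‖ξ‖) (h' : ‖ξ‖ ≤ 8 / 3) {z : C3}
    (hz : inner ℂ (complexify ξ) z = 0) : lerayBump ξ z = z := by
  rw [lerayBump_apply, hz, annulusBump_eq_one h h']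
  simp

theorem lerayBump_neg_conjC3 (ξ : R3) (z : C3) :
    lerayBump (-ξ) (conjC3 z) = conjC3 (lerayBump ξ z) := by
  have h : inner ℂ (complexify ξ) (conjC3 z) =
      (starRingEnd ℂ) (inner ℂ (complexify ξ) z) := by
    simp [inner_complexify]
  rw [lerayBump_apply, lerayBump_apply, annulusBump_neg, map_smul, map_sub, map_smul, conjC3_smul,
    conjC3_complexify, map_neg, norm_neg, inner_neg_left, h]
  simp

/-- The dilate `lerayBump (2^{-k} ·)` of the symbol (see `dyadicSymbol`) as a Schwartz function. -/
def lerayShell (k : ℤ) : 𝓢(R3, C3 →L[ℂ] C3) :=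
  (hasCompactSupport_lerayBump.dyadicSymbol k).toSchwartzMap (contDiff_lerayBump.dyadicSymbol k)

theorem lerayShell_apply (k : ℤ) (ξ : R3) :
    lerayShell k ξ = lerayBump ((2 : ℝ) ^ (-k) • ((2 * Real.pi) • ξ)) := rfl

/-- The `L¹` norm of the kernel of the localized projection. -/
def lerayKernelNorm : ℝ≥0∞ := ∫⁻ x, ‖𝓕⁻ lerayBump x‖ₑ

theorem lerayKernelNorm_ne_top : lerayKernelNorm ≠ ⊤ := by
  have h2 := (𝓕⁻ (hasCompactSupport_lerayBump.toSchwartzMap contDiff_lerayBump) :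
    𝓢(R3, C3 →L[ℂ] C3)).integrable (μ := volume)
  rw [SchwartzMap.fourierInv_coe] at h2
  exact h2.2.ne

theorem lintegral_fourierInv_lerayShell (k : ℤ) :
    ∫⁻ x, ‖𝓕⁻ (lerayShell k : R3 → C3 →L[ℂ] C3) x‖ₑ = lerayKernelNorm := by
  have h1 : (lerayShell k : R3 → C3 →L[ℂ] C3) =
      fun ξ => lerayBump (((2 : ℝ) ^ (-k) * (2 * Real.pi)) • ξ) := by
    ext1 ξ
    rw [lerayShell_apply, smul_smul]
  rw [h1, lintegral_fourierInv_comp_smul lerayBump (dyadicScale_pos k), lerayKernelNorm]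

/-- The localized projections are bounded on `Lᵖ`, uniformly in the shell. -/
theorem eLpNorm_lerayShell_le {k : ℤ} {v w : C3Field}
    (h : ∀ᵐ ξ, (𝓕 w : C3Field) ξ = lerayShell k ξ ((𝓕 v : C3Field) ξ)) {p : ℝ} (hp : 1 < p) :
    eLpNorm w (ENNReal.ofReal p) volume ≤
      lerayKernelNorm * eLpNorm v (ENNReal.ofReal p) volume := by
  rw [← lintegral_fourierInv_lerayShell k]
  exact eLpNorm_fourierMultiplier_le (ContinuousLinearMap.id ℂ (C3 →L[ℂ] C3))
    ContinuousLinearMap.norm_id_le (lerayShell k) v w h hp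

theorem norm_lerayShell_le (k : ℤ) (ξ : R3) (z : C3) : ‖lerayShell k ξ z‖ ≤ ‖z‖ :=
  norm_lerayBump_le _ _

theorem inner_lerayShell (k : ℤ) (ξ : R3) (z : C3) :
    inner ℂ (complexify ξ) (lerayShell k ξ z) = 0 := by
  have h := inner_lerayBump ((2 : ℝ) ^ (-k) • ((2 * Real.pi) • ξ)) z
  rw [← lerayShell_apply, smul_smul, map_smul, ← Complex.coe_smul, inner_smul_left] at h
  refine (mul_eq_zero.1 h).resolve_left ?_
  rw [Complex.conj_ofReal]
  exact_mod_cast (dyadicScale_pos k).ne'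

theorem lerayShell_neg_conjC3 (k : ℤ) (ξ : R3) (z : C3) :
    lerayShell k (-ξ) (conjC3 z) = conjC3 (lerayShell k ξ z) := by
  simp only [lerayShell_apply, smul_neg, lerayBump_neg_conjC3]

/-- On divergence-free fields, the localized projection is the identity on the support of the
Littlewood-Paley block. -/
theorem lerayShell_dyadicSymbol_smul {φ : R3 → ℝ} (hφ : IsLittlewoodPaley φ) (k : ℤ) {ξ : R3}
    {z : C3} (hz : inner ℂ (complexify ξ) z = 0) :
    lerayShell k ξ (((dyadicSymbol φ k ξ : ℝ) : ℂ) • z) =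
      ((dyadicSymbol φ k ξ : ℝ) : ℂ) • z := by
  rw [map_smul]
  by_cases h : 3 / 4 ≤ ‖(2 : ℝ) ^ (-k) • ((2 * Real.pi) • ξ)‖ ∧
      ‖(2 : ℝ) ^ (-k) • ((2 * Real.pi) • ξ)‖ ≤ 8 / 3
  · rw [lerayShell_apply, lerayBump_eq_self h.1 h.2]
    rw [smul_smul, map_smul, ← Complex.coe_smul, inner_smul_left, hz, mul_zero]
  · have : dyadicSymbol φ k ξ = 0 := hφ.eq_zero h
    simp [this]

theorem norm_dyadicScale_smul (k : ℤ) (ξ : R3) :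
    ‖(2 : ℝ) ^ (-k) • ((2 * Real.pi) • ξ)‖ = 2 ^ (-k) * ‖(2 * Real.pi) • ξ‖ := by
  rw [norm_smul, Real.norm_of_nonneg (by positivity)]

/-- A frequency lies in at most four of the shells `{1/2 ≤ 2^{-k} |2πξ| ≤ 4}`. -/
theorem exists_shells (ξ : R3) : ∃ n : ℤ, ∀ k : ℤ,
    1 / 2 ≤ ‖(2 : ℝ) ^ (-k) • ((2 * Real.pi) • ξ)‖ → ‖(2 : ℝ) ^ (-k) • ((2 * Real.pi) • ξ)‖ ≤ 4 →
      k ∈ Finset.Icc (n - 2) (n + 1) := by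
  by_cases hξ : ξ = 0
  · refine ⟨0, fun k h => ?_⟩
    simp [hξ] at h
    linarith
  have hR : 0 < ‖(2 * Real.pi) • ξ‖ := norm_pos_iff.2 (smul_ne_zero (by positivity) hξ)
  obtain ⟨n, hn1, hn2⟩ := exists_mem_Ico_zpow hR one_lt_two
  refine ⟨n, fun k h1 h2 => ?_⟩
  rw [norm_dyadicScale_smul] at h1 h2
  have hk : (0 : ℝ) < 2 ^ k := by positivity
  have h3 : (2 : ℝ) ^ (k - 1) ≤ ‖(2 * Real.pi) • ξ‖ := by
    rw [zpow_sub_one₀ two_ne_zero]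
    rw [zpow_neg, inv_mul_eq_div, le_div_iff₀ hk] at h1
    linarith
  have h4 : ‖(2 * Real.pi) • ξ‖ ≤ (2 : ℝ) ^ (k + 2) := by
    rw [zpow_add₀ two_ne_zero]
    rw [zpow_neg, inv_mul_eq_div, div_le_iff₀ hk] at h2
    norm_num
    linarith
  have h5 : k - 1 < n + 1 := (zpow_lt_zpow_iff_right₀ one_lt_two).1 (h3.trans_lt hn2)
  have h6 : n ≤ k + 2 := (zpow_le_zpow_iff_right₀ one_lt_two).1 (hn1.trans h4)
  rw [Finset.mem_Icc]
  omega

theorem lerayShell_eq_zero {k : ℤ} {ξ : R3}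
    (h : ¬ (1 / 2 ≤ ‖(2 : ℝ) ^ (-k) • ((2 * Real.pi) • ξ)‖ ∧
      ‖(2 : ℝ) ^ (-k) • ((2 * Real.pi) • ξ)‖ ≤ 4)) : lerayShell k ξ = 0 :=
  lerayBump_eq_zero h

theorem exists_lerayShell_eq_zero (ξ : R3) :
    ∃ n : ℤ, ∀ k ∉ Finset.Icc (n - 2) (n + 1), lerayShell k ξ = 0 := by
  obtain ⟨n, hn⟩ := exists_shells ξ
  exact ⟨n, fun k hk => lerayShell_eq_zero fun h => hk (hn k h.1 h.2)⟩

/-! ### Fields assembled from pieces on dyadic shells -/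

/-- The Fourier transform of `∑ₖ Pₖ hₖ`, where `Pₖ` is the projection localized to the `k`-th
shell. At every frequency at most four terms do not vanish. -/
def assemble (h : ℤ → C3Field) (ξ : R3) : C3 :=
  ∑' k : ℤ, lerayShell k ξ ((𝓕 (h k) : C3Field) ξ)

theorem summable_assemble (h : ℤ → C3Field) (ξ : R3) :
    Summable fun k : ℤ => lerayShell k ξ ((𝓕 (h k) : C3Field) ξ) := by
  obtain ⟨n, hn⟩ := exists_lerayShell_eq_zero ξ
  exact summable_of_ne_finset_zero (s := Finset.Icc (n - 2) (n + 1)) fun k hk => by simp [hn k hk]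

theorem stronglyMeasurable_assemble (h : ℤ → C3Field) : StronglyMeasurable (assemble h) := by
  refine stronglyMeasurable_of_tendsto (u := Filter.atTop)
    (f := fun (s : Finset ℤ) ξ => ∑ k ∈ s, lerayShell k ξ ((𝓕 (h k) : C3Field) ξ)) (fun s => ?_) ?_
  · refine Finset.stronglyMeasurable_fun_sum s fun k _ => ?_
    have h1 : StronglyMeasurable (lerayShell k) := (lerayShell k).continuous.stronglyMeasurable
    have h2 : StronglyMeasurable (𝓕 (h k) : C3Field) := Lp.stronglyMeasurable _
    exact (isBoundedBilinearMap_apply (𝕜 := ℂ) (E := C3) (F := C3)).continuous.comp_stronglyMeasurable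
      (h1.prodMk h2)
  · rw [tendsto_pi_nhds]
    exact fun ξ => (summable_assemble h ξ).hasSum

theorem enorm_assemble_sq_le (h : ℤ → C3Field) {α : ℝ} (hα : 0 ≤ α) (ξ : R3) :
    ‖(2 * Real.pi) • ξ‖ₑ ^ (2 * α) * ‖assemble h ξ‖ₑ ^ (2 : ℝ) ≤
      ENNReal.ofReal (4 * 16 ^ α) * ∑' k : ℤ, ENNReal.ofReal (2 ^ ((k : ℝ) * (2 * α))) *
        ‖(𝓕 (h k) : C3Field) ξ‖ₑ ^ (2 : ℝ) := by
  obtain ⟨n, hn⟩ := exists_lerayShell_eq_zero ξ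
  set S := Finset.Icc (n - 2) (n + 1) with hS
  have hcard : (S.card : ℝ≥0∞) = 4 := by
    rw [hS, Int.card_Icc]
    have : (n + 1 + 1 - (n - 2)).toNat = 4 := by omega
    rw [this]; norm_num
  have h1 : assemble h ξ = ∑ k ∈ S, lerayShell k ξ ((𝓕 (h k) : C3Field) ξ) :=
    tsum_eq_sum fun k hk => by simp [hn k hk]
  have hterm : ∀ k, ‖(2 * Real.pi) • ξ‖ₑ ^ (2 * α) *
      ‖lerayShell k ξ ((𝓕 (h k) : C3Field) ξ)‖ₑ ^ (2 : ℝ) ≤ ENNReal.ofReal (16 ^ α) *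
        (ENNReal.ofReal (2 ^ ((k : ℝ) * (2 * α))) * ‖(𝓕 (h k) : C3Field) ξ‖ₑ ^ (2 : ℝ)) := by
    intro k
    by_cases hk : 1 / 2 ≤ ‖(2 : ℝ) ^ (-k) • ((2 * Real.pi) • ξ)‖ ∧
      ‖(2 : ℝ) ^ (-k) • ((2 * Real.pi) • ξ)‖ ≤ 4
    · have h2 := hk.2
      have hk0 : (0 : ℝ) < 2 ^ k := by positivity
      rw [norm_dyadicScale_smul, zpow_neg, inv_mul_eq_div, div_le_iff₀ hk0] at h2
      rw [← mul_assoc, ← ENNReal.ofReal_mul (by positivity)]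
      gcongr
      · rw [← ofReal_norm, ENNReal.ofReal_rpow_of_nonneg (norm_nonneg _) (by positivity)]
        refine ENNReal.ofReal_le_ofReal ?_
        calc ‖(2 * Real.pi) • ξ‖ ^ (2 * α) ≤ (4 * 2 ^ k) ^ (2 * α) := by gcongr
          _ = _ := by
            have e1 : (4 : ℝ) ^ (2 * α) = 16 ^ α := by
              rw [Real.rpow_mul (by norm_num)]
              norm_num
            have e2 : ((2 : ℝ) ^ k) ^ (2 * α) = 2 ^ ((k : ℝ) * (2 * α)) := by
              rw [Real.rpow_mul zero_le_two (k : ℝ), Real.rpow_intCast]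
            rw [Real.mul_rpow (by norm_num) hk0.le, e1, e2]
      · exact enorm_le_iff_norm_le.2 (norm_lerayShell_le k ξ _)
    · rw [lerayShell_eq_zero hk]
      simp
  calc _ ≤ ‖(2 * Real.pi) • ξ‖ₑ ^ (2 * α) *
        (4 * ∑ k ∈ S, ‖lerayShell k ξ ((𝓕 (h k) : C3Field) ξ)‖ₑ ^ (2 : ℝ)) := by
        gcongr
        rw [h1]
        refine (ENNReal.rpow_le_rpow (enorm_sum_le _ _) (by norm_num)).trans ?_
        refine (ENNReal.rpow_sum_le_const_mul_sum_rpow _ _ (by norm_num)).trans ?_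
        rw [hcard]
        norm_num
    _ = 4 * ∑ k ∈ S, ‖(2 * Real.pi) • ξ‖ₑ ^ (2 * α) *
          ‖lerayShell k ξ ((𝓕 (h k) : C3Field) ξ)‖ₑ ^ (2 : ℝ) := by
        rw [← Finset.mul_sum]; ring
    _ ≤ 4 * ∑ k ∈ S, ENNReal.ofReal (16 ^ α) * (ENNReal.ofReal (2 ^ ((k : ℝ) * (2 * α))) *
          ‖(𝓕 (h k) : C3Field) ξ‖ₑ ^ (2 : ℝ)) := by
        exact mul_le_mul' le_rfl (Finset.sum_le_sum fun k _ => hterm k)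
    _ ≤ 4 * ∑' k : ℤ, ENNReal.ofReal (16 ^ α) * (ENNReal.ofReal (2 ^ ((k : ℝ) * (2 * α))) *
          ‖(𝓕 (h k) : C3Field) ξ‖ₑ ^ (2 : ℝ)) := by
        exact mul_le_mul' le_rfl (ENNReal.sum_le_tsum S)
    _ = _ := by
        rw [ENNReal.tsum_mul_left, ENNReal.ofReal_mul (by norm_num), ← mul_assoc]
        norm_num

theorem lintegral_enorm_sq (v : C3Field) :
    ∫⁻ x, ‖v x‖ₑ ^ (2 : ℝ) = ‖v‖ₑ ^ (2 : ℝ) := by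
  rw [Lp.enorm_def, eLpNorm_eq_lintegral_rpow_enorm_toReal (by norm_num) (by norm_num)]
  rw [ENNReal.toReal_ofNat, ← ENNReal.rpow_mul, one_div_mul_cancel (by norm_num),
    ENNReal.rpow_one]

theorem lintegral_enorm_fourier_sq (v : C3Field) :
    ∫⁻ x, ‖(𝓕 v : C3Field) x‖ₑ ^ (2 : ℝ) = ‖v‖ₑ ^ (2 : ℝ) := by
  rw [lintegral_enorm_sq, ← ofReal_norm, Lp.norm_fourier_eq, ofReal_norm]

/-- Near-orthogonality of the shells, in homogeneous Sobolev spaces; `α = 0` is the case of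
`L²`. -/
theorem lintegral_assemble_le (h : ℤ → C3Field) {α : ℝ} (hα : 0 ≤ α) :
    ∫⁻ ξ, ‖(2 * Real.pi) • ξ‖ₑ ^ (2 * α) * ‖assemble h ξ‖ₑ ^ (2 : ℝ) ≤
      ENNReal.ofReal (4 * 16 ^ α) * ∑' k : ℤ, ENNReal.ofReal (2 ^ ((k : ℝ) * (2 * α))) *
        ‖h k‖ₑ ^ (2 : ℝ) := by
  have hm : ∀ k, Measurable fun ξ => ‖(𝓕 (h k) : C3Field) ξ‖ₑ ^ (2 : ℝ) := fun k =>
    (Lp.stronglyMeasurable (𝓕 (h k) : C3Field)).enorm.pow_const _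
  refine (lintegral_mono fun ξ => enorm_assemble_sq_le h hα ξ).trans (le_of_eq ?_)
  rw [lintegral_const_mul' _ _ ENNReal.ofReal_ne_top,
    lintegral_tsum fun k => ((hm k).const_mul _).aemeasurable]
  congr 2
  ext k
  rw [lintegral_const_mul _ (hm k), lintegral_enorm_fourier_sq]

theorem exists_fourier_ae_eq {G : R3 → C3} (hG : MemLp G 2 (volume : Measure R3)) :
    ∃ w : C3Field, (𝓕 w : C3Field) =ᵐ[volume] G := by
  refine ⟨𝓕⁻ (hG.toLp G), ?_⟩
  rw [FourierTransform.fourier_fourierInv_eq]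
  exact hG.coeFn_toLp

theorem exists_fourier_ae_eq_assemble {h : ℤ → C3Field} (hh : ∑' k, ‖h k‖ₑ ^ (2 : ℝ) ≠ ⊤) :
    ∃ w : C3Field, (𝓕 w : C3Field) =ᵐ[volume] assemble h ∧
      ‖w‖ₑ ^ (2 : ℝ) ≤ 4 * ∑' k, ‖h k‖ₑ ^ (2 : ℝ) := by
  have h1 := lintegral_assemble_le h le_rfl
  simp only [mul_zero, ENNReal.rpow_zero, one_mul, Real.rpow_zero, ENNReal.ofReal_one, mul_one] at h1
  have h4 : ENNReal.ofReal 4 = 4 := by norm_num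
  rw [h4] at h1
  obtain ⟨w, hw⟩ := exists_fourier_ae_eq (G := assemble h)
    ⟨(stronglyMeasurable_assemble h).aestronglyMeasurable, by
      rw [eLpNorm_lt_top_iff_lintegral_rpow_enorm_lt_top (by norm_num) (by norm_num)]
      exact h1.trans_lt (ENNReal.mul_lt_top (by norm_num) hh.lt_top)⟩
  refine ⟨w, hw, ?_⟩
  rw [← lintegral_enorm_fourier_sq, lintegral_congr_ae (hw.mono fun ξ hξ => by rw [hξ])]
  exact h1

theorem isHermitian_assemble {h : ℤ → C3Field} (hh : ∀ k, IsRealField (h k)) :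
    IsHermitian (assemble h) := by
  filter_upwards [ae_all_iff.2 fun k => (hh k).isHermitian_fourier] with ξ hξ
  rw [assemble, assemble, ContinuousLinearMap.map_tsum _ (summable_assemble h ξ)]
  refine tsum_congr fun k => ?_
  rw [hξ k, lerayShell_neg_conjC3]

theorem inner_assemble (h : ℤ → C3Field) (ξ : R3) :
    inner ℂ (complexify ξ) (assemble h ξ) = 0 := by
  have := (innerSL ℂ (complexify ξ)).map_tsum (summable_assemble h ξ)
  simp only [innerSL_apply_apply, inner_lerayShell, tsum_zero] at this
  exact this

/-! ### Truncation by amplitude -/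

theorem measurableSet_amplitude_le (f : C3Field) (a : ℝ) : MeasurableSet {x | ‖f x‖ ≤ a} :=
  (Lp.stronglyMeasurable f).norm.measurable measurableSet_Iic

/-- The part of a field where its amplitude is at most `a`. -/
def lowPart (f : C3Field) (a : ℝ) : C3Field :=
  ((Lp.memLp f).indicator (measurableSet_amplitude_le f a)).toLp _

/-- The part of a field where its amplitude exceeds `a`. -/
def highPart (f : C3Field) (a : ℝ) : C3Field := f - lowPart f a

theorem coeFn_lowPart (f : C3Field) (a : ℝ) :
    ∀ᵐ x, lowPart f a x = if ‖f x‖ ≤ a then f x else 0 := by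
  filter_upwards [((Lp.memLp f).indicator (measurableSet_amplitude_le f a)).coeFn_toLp] with x hx
  rw [lowPart, hx, Set.indicator_apply]
  rfl

theorem coeFn_highPart (f : C3Field) (a : ℝ) :
    ∀ᵐ x, highPart f a x = if ‖f x‖ ≤ a then 0 else f x := by
  filter_upwards [coeFn_lowPart f a, Lp.coeFn_sub f (lowPart f a)] with x h1 h2
  rw [highPart, h2, Pi.sub_apply, h1]
  split_ifs <;> simp

theorem IsRealField.lowPart {f : C3Field} (hf : IsRealField f) (a : ℝ) :
    IsRealField (lowPart f a) := by
  filter_upwards [hf, coeFn_lowPart f a] with x h1 h2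
  rw [h2]
  split_ifs
  · exact h1
  · exact map_zero _

theorem enorm_lowPart_le (f : C3Field) (a : ℝ) : ‖lowPart f a‖ₑ ≤ ‖f‖ₑ := by
  rw [enorm_le_iff_norm_le]
  refine Lp.norm_le_norm_of_ae_le ?_
  filter_upwards [coeFn_lowPart f a] with x hx
  rw [hx]
  split_ifs
  · exact le_rfl
  · simp

theorem eLpNorm_ofReal_rpow (f : R3 → C3) {p : ℝ} (hp : 0 < p) :
    eLpNorm f (ENNReal.ofReal p) volume ^ p = ∫⁻ x, ‖f x‖ₑ ^ p := by
  rw [eLpNorm_eq_lintegral_rpow_enorm_toReal (by simpa using hp) ENNReal.ofReal_ne_top,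
    ENNReal.toReal_ofReal hp.le, ← ENNReal.rpow_mul, one_div_mul_cancel hp.ne', ENNReal.rpow_one]

theorem eLpNorm_lowPart_le (f : C3Field) {a p q : ℝ} (ha : 0 < a) (hq : 0 < q) (hqp : q ≤ p) :
    eLpNorm (lowPart f a) (ENNReal.ofReal p) volume ^ p ≤
      ENNReal.ofReal (a ^ (p - q)) * eLpNorm f (ENNReal.ofReal q) volume ^ q := by
  rw [eLpNorm_ofReal_rpow _ (hq.trans_le hqp), eLpNorm_ofReal_rpow _ hq,
    ← lintegral_const_mul' _ _ ENNReal.ofReal_ne_top]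
  refine lintegral_mono_ae ?_
  filter_upwards [coeFn_lowPart f a] with x hx
  rw [hx]
  split_ifs with h
  · have h1 : ‖f x‖ₑ ^ p = ‖f x‖ₑ ^ (p - q) * ‖f x‖ₑ ^ q := by
      rw [← ENNReal.rpow_add_of_nonneg _ _ (by linarith) hq.le]
      ring_nf
    rw [h1]
    gcongr
    rw [← ENNReal.ofReal_rpow_of_pos ha]
    refine ENNReal.rpow_le_rpow ?_ (by linarith)
    rw [← ofReal_norm]
    exact ENNReal.ofReal_le_ofReal h
  · simp [hq.trans_le hqp]

theorem enorm_highPart_sq_le (f : C3Field) {a q : ℝ} (ha : 0 < a) (hq : 2 ≤ q) :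
    ‖highPart f a‖ₑ ^ (2 : ℝ) ≤
      ENNReal.ofReal (a ^ (2 - q)) * eLpNorm f (ENNReal.ofReal q) volume ^ q := by
  rw [← lintegral_enorm_sq, eLpNorm_ofReal_rpow _ (show 0 < q by linarith),
    ← lintegral_const_mul' _ _ ENNReal.ofReal_ne_top]
  refine lintegral_mono_ae ?_
  filter_upwards [coeFn_highPart f a] with x hx
  rw [hx]
  split_ifs with h
  · simp
  · rw [not_le] at h
    have h0 : 0 < ‖f x‖ := ha.trans h
    rw [← ofReal_norm, ENNReal.ofReal_rpow_of_pos h0, ENNReal.ofReal_rpow_of_pos h0,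
      ← ENNReal.ofReal_mul (by positivity)]
    refine ENNReal.ofReal_le_ofReal ?_
    calc ‖f x‖ ^ (2 : ℝ) = ‖f x‖ ^ (2 - q) * ‖f x‖ ^ q := by
          rw [← Real.rpow_add h0]; ring_nf
      _ ≤ a ^ (2 - q) * ‖f x‖ ^ q := by
          exact mul_le_mul_of_nonneg_right
            (Real.rpow_le_rpow_of_nonpos ha h.le (by linarith)) (by positivity)

/-! ### Besov norms of assembled fields -/

namespace IsLittlewoodPaley

variable {φ : R3 → ℝ} (hφ : IsLittlewoodPaley φ)
include hφ

theorem exists_dyadicBlock (j : ℤ) (v : C3Field) : ∃ w : C3Field,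
    ∀ᵐ ξ, (𝓕 w : C3Field) ξ = ((dyadicSymbol φ j ξ : ℝ) : ℂ) • (𝓕 v : C3Field) ξ := by
  refine exists_fourier_ae_eq
    (G := fun ξ => ((dyadicSymbol φ j ξ : ℝ) : ℂ) • (𝓕 v : C3Field) ξ) ?_
  refine (Lp.memLp (𝓕 v : C3Field)).mono
    ((hφ.schwartzSymbol j).continuous.aestronglyMeasurable.smul (Lp.aestronglyMeasurable _))
    (Filter.Eventually.of_forall fun ξ => ?_)
  rw [norm_smul, Complex.norm_real, Real.norm_of_nonneg (hφ.dyadicSymbol_nonneg j ξ)]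
  exact mul_le_of_le_one_left (norm_nonneg _) (hφ.dyadicSymbol_le_one j ξ)

omit hφ in
theorem exists_lerayShell (k : ℤ) (v : C3Field) : ∃ w : C3Field,
    ∀ᵐ ξ, (𝓕 w : C3Field) ξ = lerayShell k ξ ((𝓕 v : C3Field) ξ) := by
  refine exists_fourier_ae_eq (G := fun ξ => lerayShell k ξ ((𝓕 v : C3Field) ξ)) ?_
  refine (Lp.memLp (𝓕 v : C3Field)).mono
    ((ContinuousLinearMap.id ℂ (C3 →L[ℂ] C3)).aestronglyMeasurable_comp₂
      (lerayShell k).continuous.aestronglyMeasurable (Lp.aestronglyMeasurable _))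
    (Filter.Eventually.of_forall fun ξ => norm_lerayShell_le k ξ _)

/-- Only the pieces of the seven neighbouring shells enter a block of an assembled field. -/
theorem dyadicSymbol_smul_assemble (h : ℤ → C3Field) (j : ℤ) (ξ : R3) :
    ((dyadicSymbol φ j ξ : ℝ) : ℂ) • assemble h ξ = ∑ i ∈ Finset.Icc (-3 : ℤ) 3,
      ((dyadicSymbol φ j ξ : ℝ) : ℂ) • lerayShell (j + i) ξ ((𝓕 (h (j + i)) : C3Field) ξ) := by
  by_cases hj : dyadicSymbol φ j ξ = 0
  · simp [hj]
  have hj' : 3 / 4 ≤ ‖(2 : ℝ) ^ (-j) • ((2 * Real.pi) • ξ)‖ ∧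
      ‖(2 : ℝ) ^ (-j) • ((2 * Real.pi) • ξ)‖ ≤ 8 / 3 := by
    by_contra h'
    exact hj (hφ.eq_zero h')
  obtain ⟨n, hn⟩ := exists_shells ξ
  have hjn := Finset.mem_Icc.1 (hn j (by linarith [hj'.1]) (by linarith [hj'.2]))
  rw [← Finset.smul_sum]
  congr 1
  rw [assemble, ← (Equiv.addLeft j).tsum_eq]
  refine tsum_eq_sum fun i hi => ?_
  rw [Equiv.coe_addLeft, lerayShell_eq_zero, zero_apply]
  intro h'
  have : n - 2 ≤ j + i ∧ j + i ≤ n + 1 := Finset.mem_Icc.1 (hn _ h'.1 h'.2)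
  refine hi (Finset.mem_Icc.2 ?_)
  omega

theorem distLpNorm_dyadicBlock_assemble_le {h : ℤ → C3Field} {w : C3Field}
    (hw : (𝓕 w : C3Field) =ᵐ[volume] assemble h) (j : ℤ) {p : ℝ} (hp : 1 < p) :
    distLpNorm (ENNReal.ofReal p) (dyadicBlock φ j (Lp.toTemperedDistribution w)) ≤
      ENNReal.ofReal (invFourierL1Norm φ) * lerayKernelNorm *
        ∑ i ∈ Finset.Icc (-3 : ℤ) 3, eLpNorm (h (j + i)) (ENNReal.ofReal p) volume := by
  choose P hP using fun k => exists_lerayShell k (h k)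
  choose Q hQ using fun k => hφ.exists_dyadicBlock j (P k)
  have hsum : ∀ᵐ ξ, (𝓕 (∑ i ∈ Finset.Icc (-3 : ℤ) 3, Q (j + i)) : C3Field) ξ =
      ((dyadicSymbol φ j ξ : ℝ) : ℂ) • (𝓕 w : C3Field) ξ := by
    rw [FourierTransform.fourier_sum]
    filter_upwards [Lp.coeFn_fun_finsetSum (Finset.Icc (-3 : ℤ) 3)
      (fun i => (𝓕 (Q (j + i)) : C3Field)), ae_all_iff.2 hP, ae_all_iff.2 hQ, hw]
      with ξ h1 h2 h3 h4
    rw [h1, h4, hφ.dyadicSymbol_smul_assemble h j ξ]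
    refine Finset.sum_congr rfl fun i _ => ?_
    rw [h3, h2]
  rw [hφ.dyadicBlock_toTemperedDistribution hsum, distLpNorm_toTemperedDistribution]
  have h1p : 1 ≤ ENNReal.ofReal p := by
    rw [← ENNReal.ofReal_one]
    exact ENNReal.ofReal_le_ofReal hp.le
  calc eLpNorm (∑ i ∈ Finset.Icc (-3 : ℤ) 3, Q (j + i) : C3Field) (ENNReal.ofReal p) volume
      = eLpNorm (∑ i ∈ Finset.Icc (-3 : ℤ) 3, (Q (j + i) : R3 → C3)) (ENNReal.ofReal p) volume :=
        eLpNorm_congr_ae (Lp.coeFn_finsetSum _ _)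
    _ ≤ ∑ i ∈ Finset.Icc (-3 : ℤ) 3, eLpNorm (Q (j + i)) (ENNReal.ofReal p) volume :=
        eLpNorm_sum_le (fun i _ => Lp.aestronglyMeasurable _) h1p
    _ ≤ ∑ i ∈ Finset.Icc (-3 : ℤ) 3, ENNReal.ofReal (invFourierL1Norm φ) *
          (lerayKernelNorm * eLpNorm (h (j + i)) (ENNReal.ofReal p) volume) := by
        refine Finset.sum_le_sum fun i _ => ?_
        refine (hφ.eLpNorm_dyadicBlock_le (hQ (j + i)) hp).trans ?_
        gcongr
        exact eLpNorm_lerayShell_le (hP (j + i)) hp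
    _ = _ := by
        simp only [← mul_assoc]
        rw [Finset.mul_sum]

omit hφ in
theorem besovNorm_rpow (σ : ℝ) {p : ℝ} (hp : 0 < p) (T : 𝓢'(R3, C3)) :
    besovNorm φ σ p p T ^ p = ∑' j : ℤ, (ENNReal.ofReal ((2 : ℝ) ^ ((j : ℝ) * σ)) *
      distLpNorm (ENNReal.ofReal p) (dyadicBlock φ j T)) ^ p := by
  rw [besovNorm, ← ENNReal.rpow_mul, one_div_mul_cancel hp.ne', ENNReal.rpow_one]

/-- The Besov norm of an assembled field is controlled by its pieces. -/
theorem besovNorm_assemble_rpow_le {h : ℤ → C3Field} {w : C3Field}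
    (hw : (𝓕 w : C3Field) =ᵐ[volume] assemble h) (σ : ℝ) {p : ℝ} (hp : 1 < p) :
    besovNorm φ σ p p (Lp.toTemperedDistribution w) ^ p ≤
      (7 * ENNReal.ofReal (8 ^ |σ|) * (ENNReal.ofReal (invFourierL1Norm φ) * lerayKernelNorm)) ^ p *
        ∑' k : ℤ, ENNReal.ofReal ((2 : ℝ) ^ ((k : ℝ) * (σ * p))) *
          eLpNorm (h k) (ENNReal.ofReal p) volume ^ p := by
  have hp0 : 0 < p := by linarith
  set D := ENNReal.ofReal (invFourierL1Norm φ) * lerayKernelNorm with hD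
  set a : ℤ → ℝ≥0∞ := fun k => ENNReal.ofReal ((2 : ℝ) ^ ((k : ℝ) * σ)) *
    eLpNorm (h k) (ENNReal.ofReal p) volume with ha
  have hap : ∀ k : ℤ, ENNReal.ofReal ((2 : ℝ) ^ ((k : ℝ) * (σ * p))) *
      eLpNorm (h k) (ENNReal.ofReal p) volume ^ p = a k ^ p := by
    intro k
    rw [ha, ENNReal.mul_rpow_of_nonneg _ _ hp0.le, ENNReal.ofReal_rpow_of_pos (by positivity),
      ← Real.rpow_mul zero_le_two, mul_assoc]
  simp only [hap]
  rw [besovNorm_rpow σ hp0]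
  have hcard : ((Finset.Icc (-3 : ℤ) 3).card : ℝ≥0∞) = 7 := by
    rw [show (Finset.Icc (-3 : ℤ) 3).card = 7 from rfl]
    norm_num
  -- the weights of shells at distance at most `3` differ by at most the factor `8 ^ |σ|`
  have hshift : ∀ j : ℤ, ∀ i ∈ Finset.Icc (-3 : ℤ) 3, ENNReal.ofReal ((2 : ℝ) ^ ((j : ℝ) * σ)) *
      eLpNorm (h (j + i)) (ENNReal.ofReal p) volume ≤ ENNReal.ofReal (8 ^ |σ|) * a (j + i) := by
    intro j i hi
    rw [ha, ← mul_assoc, ← ENNReal.ofReal_mul (by positivity)]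
    gcongr
    rw [show (8 : ℝ) = 2 ^ (3 : ℝ) by norm_num, ← Real.rpow_mul zero_le_two,
      ← Real.rpow_add zero_lt_two]
    refine Real.rpow_le_rpow_of_exponent_le one_le_two ?_
    have hi' : |(i : ℝ)| ≤ 3 := by
      rw [Finset.mem_Icc] at hi
      rw [abs_le]
      exact ⟨by exact_mod_cast hi.1, by exact_mod_cast hi.2⟩
    have h1 : -((i : ℝ) * σ) ≤ 3 * |σ| := by
      refine (neg_le_abs _).trans ?_
      rw [abs_mul]
      gcongr
    push_cast
    linarith
  have hblock : ∀ j : ℤ, (ENNReal.ofReal ((2 : ℝ) ^ ((j : ℝ) * σ)) *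
      distLpNorm (ENNReal.ofReal p) (dyadicBlock φ j (Lp.toTemperedDistribution w))) ^ p ≤
      (D * ENNReal.ofReal (8 ^ |σ|)) ^ p * (7 ^ (p - 1) *
        ∑ i ∈ Finset.Icc (-3 : ℤ) 3, a (j + i) ^ p) := by
    intro j
    have h1 : ENNReal.ofReal ((2 : ℝ) ^ ((j : ℝ) * σ)) *
        distLpNorm (ENNReal.ofReal p) (dyadicBlock φ j (Lp.toTemperedDistribution w)) ≤
        (D * ENNReal.ofReal (8 ^ |σ|)) * ∑ i ∈ Finset.Icc (-3 : ℤ) 3, a (j + i) := by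
      calc _ ≤ ENNReal.ofReal ((2 : ℝ) ^ ((j : ℝ) * σ)) * (D *
            ∑ i ∈ Finset.Icc (-3 : ℤ) 3, eLpNorm (h (j + i)) (ENNReal.ofReal p) volume) := by
            gcongr
            exact hφ.distLpNorm_dyadicBlock_assemble_le hw j hp
        _ = D * ∑ i ∈ Finset.Icc (-3 : ℤ) 3, ENNReal.ofReal ((2 : ℝ) ^ ((j : ℝ) * σ)) *
              eLpNorm (h (j + i)) (ENNReal.ofReal p) volume := by
            rw [← Finset.mul_sum]; ring
        _ ≤ D * ∑ i ∈ Finset.Icc (-3 : ℤ) 3, ENNReal.ofReal (8 ^ |σ|) * a (j + i) :=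
            mul_le_mul' le_rfl (Finset.sum_le_sum (hshift j))
        _ = _ := by rw [← Finset.mul_sum]; ring
    refine (ENNReal.rpow_le_rpow h1 hp0.le).trans ?_
    rw [ENNReal.mul_rpow_of_nonneg _ _ hp0.le]
    gcongr
    refine (ENNReal.rpow_sum_le_const_mul_sum_rpow _ _ hp.le).trans ?_
    rw [hcard]
  refine (ENNReal.tsum_le_tsum hblock).trans (le_of_eq ?_)
  rw [ENNReal.tsum_mul_left, ENNReal.tsum_mul_left, Summable.tsum_finsetSum
    fun i _ => ENNReal.summable]
  have hsh : ∀ i : ℤ, ∑' j : ℤ, a (j + i) ^ p = ∑' k, a k ^ p := fun i =>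
    (Equiv.addRight i).tsum_eq fun k => a k ^ p
  simp only [hsh]
  rw [Finset.sum_const, nsmul_eq_mul, hcard, ← mul_assoc, ← mul_assoc]
  congr 1
  have h7 : (7 : ℝ≥0∞) ^ (p - 1) * 7 = 7 ^ p := by
    conv_lhs => rw [← ENNReal.rpow_one 7, ← ENNReal.rpow_mul, one_mul]
    rw [← ENNReal.rpow_add_of_nonneg _ _ (by linarith) zero_le_one, sub_add_cancel]
  rw [mul_assoc, h7, ← ENNReal.mul_rpow_of_nonneg _ _ hp0.le]
  ring_nf

/-- The blocks of an `L²` field are square-summable in `L²`. -/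
theorem tsum_enorm_dyadicBlock_sq_le {v : C3Field} {f : ℤ → C3Field}
    (hf : ∀ k, ∀ᵐ ξ, (𝓕 (f k) : C3Field) ξ =
      ((dyadicSymbol φ k ξ : ℝ) : ℂ) • (𝓕 v : C3Field) ξ) :
    ∑' k, ‖f k‖ₑ ^ (2 : ℝ) ≤ ‖v‖ₑ ^ (2 : ℝ) := by
  simp only [← lintegral_enorm_fourier_sq]
  rw [← lintegral_tsum fun k =>
    ((Lp.stronglyMeasurable (𝓕 (f k) : C3Field)).enorm.pow_const _).aemeasurable]
  refine lintegral_mono_ae ?_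
  filter_upwards [ae_all_iff.2 hf, compl_mem_ae_iff.2 (measure_singleton (0 : R3))] with ξ h hξ
  have hs := hφ.hasSum_dyadicSymbol (ξ := ξ) hξ
  have h1 : ∀ k, ‖(𝓕 (f k) : C3Field) ξ‖ₑ ^ (2 : ℝ) ≤
      ENNReal.ofReal (dyadicSymbol φ k ξ) * ‖(𝓕 v : C3Field) ξ‖ₑ ^ (2 : ℝ) := by
    intro k
    have h0 := hφ.dyadicSymbol_nonneg k ξ
    rw [h k, enorm_smul, ENNReal.mul_rpow_of_nonneg _ _ zero_le_two, ← ofReal_norm,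
      Complex.norm_real, Real.norm_of_nonneg h0, ENNReal.ofReal_rpow_of_nonneg h0 zero_le_two]
    gcongr
    rw [Real.rpow_two, sq]
    exact mul_le_of_le_one_left h0 (hφ.dyadicSymbol_le_one k ξ)
  refine (ENNReal.tsum_le_tsum h1).trans ?_
  rw [ENNReal.tsum_mul_right, ← ENNReal.ofReal_tsum_of_nonneg
    (fun k => hφ.dyadicSymbol_nonneg k ξ) hs.summable, hs.tsum_eq]
  simp

theorem isRealField_dyadicBlock {k : ℤ} {v f : C3Field} (hv : IsRealField v)
    (hf : ∀ᵐ ξ, (𝓕 f : C3Field) ξ = ((dyadicSymbol φ k ξ : ℝ) : ℂ) • (𝓕 v : C3Field) ξ) :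
    IsRealField f := by
  refine IsHermitian.isRealField ?_
  filter_upwards [hf, ae_comp_neg hf, hv.isHermitian_fourier] with ξ h1 h2 h3
  have : dyadicSymbol φ k (-ξ) = dyadicSymbol φ k ξ := hφ.radial _ _ (by simp)
  rw [h1, h2, h3, conjC3_smul, Complex.conj_ofReal, this]

/-- A divergence-free field is assembled from its Littlewood-Paley blocks. -/
theorem assemble_dyadicBlock {v : C3Field} {f : ℤ → C3Field}
    (hf : ∀ k, ∀ᵐ ξ, (𝓕 (f k) : C3Field) ξ =
      ((dyadicSymbol φ k ξ : ℝ) : ℂ) • (𝓕 v : C3Field) ξ)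
    (hv : ∀ᵐ ξ, inner ℂ (complexify ξ) ((𝓕 v : C3Field) ξ) = 0) :
    assemble f =ᵐ[volume] (𝓕 v : C3Field) := by
  filter_upwards [ae_all_iff.2 hf, hv, compl_mem_ae_iff.2 (measure_singleton (0 : R3))]
    with ξ h h0 hξ
  have h1 : HasSum (fun j => ((dyadicSymbol φ j ξ : ℝ) : ℂ)) 1 := by
    exact_mod_cast Complex.ofRealCLM.hasSum (hφ.hasSum_dyadicSymbol (ξ := ξ) hξ)
  rw [assemble]
  simp only [h, lerayShell_dyadicSymbol_smul hφ _ h0]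
  rw [(h1.smul_const _).tsum_eq, one_smul]

end IsLittlewoodPaley

theorem assemble_add {f g h : ℤ → C3Field} (hfg : ∀ k, f k = g k + h k) :
    ∀ᵐ ξ, assemble f ξ = assemble g ξ + assemble h ξ := by
  have h1 : ∀ k, ∀ᵐ ξ, (𝓕 (f k) : C3Field) ξ =
      (𝓕 (g k) : C3Field) ξ + (𝓕 (h k) : C3Field) ξ := by
    intro k
    rw [hfg, FourierTransform.fourier_add]
    exact Lp.coeFn_add _ _
  filter_upwards [ae_all_iff.2 h1] with ξ hξ
  rw [assemble, assemble, assemble, ← (summable_assemble g ξ).tsum_add (summable_assemble h ξ)]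
  refine tsum_congr fun k => ?_
  rw [hξ k, map_add]

/-! ### The splitting -/

/-- The exponents of the splitting. The truncation heights `2^{kθ}` turn the weights of the two
target norms into those of `Ḃ^s_{q,q}`. The two equations determine `θ` and `δ`. In the limit
`α = 0` they give `δ > 0` as soon as `(q - 2 + s q) (p - 2) > q - 2`, which holds for large `p`
because `q - 2 + s q > 0`; a small `α` does no harm. -/
theorem exists_splitting_exponents {q s : ℝ} (hq : 3 < q) (hs : -1 + 2 / q < s) (hs0 : s < 0) :
    ∃ p δ α θ : ℝ, max q 4 < p ∧ 0 < δ ∧ δ < 1 - 3 / p ∧ 0 < α ∧ α < 3 / 2 ∧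
      (-1 + 3 / p + δ) * p + θ * (p - q) = s * q ∧ 2 * α + θ * (2 - q) = s * q := by
  have hq0 : 0 < q := by linarith
  have hq2 : 0 < q - 2 := by linarith
  set e := q - 2 + s * q with he
  have he0 : 0 < e := by
    have h1 : (-1 + 2 / q) * q < s * q := mul_lt_mul_of_pos_right hs hq0
    have h2 : (-1 + 2 / q) * q = -q + 2 := by field_simp
    linarith
  have hsq : s * q < 0 := mul_neg_of_neg_of_pos hs0 hq0
  set p := q + 4 + (q - 2) / e with hp
  have hdiv : 0 < (q - 2) / e := by positivity
  have hpq : q + 4 < p := by linarith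
  have hp0 : 0 < p := by linarith
  have hep : e * p = e * (q + 4) + (q - 2) := by rw [hp]; field_simp
  set α := e / (p + e) with hα
  have hα0 : 0 < α := by positivity
  have hα1 : α < 1 := by rw [hα, div_lt_one (by positivity)]; linarith
  have hαp : α * (p - q) < e := by
    have h1 : α * (p + e) = e := by rw [hα]; field_simp
    nlinarith
  set θ := (2 * α - s * q) / (q - 2) with hθ
  have hθ0 : 0 < θ := div_pos (by linarith) hq2
  have hθq : θ * (q - 2) = 2 * α - s * q := by rw [hθ]; field_simp
  have hlt : θ * (p - q) < p - 3 + s * q := by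
    have h1 : θ * (p - q) * (q - 2) < (p - 3 + s * q) * (q - 2) := by
      calc θ * (p - q) * (q - 2) = (2 * α - s * q) * (p - q) := by rw [← hθq]; ring
        _ < (p - 3 + s * q) * (q - 2) := by nlinarith
    exact lt_of_mul_lt_mul_right h1 hq2.le
  refine ⟨p, (s * q - θ * (p - q)) / p + 1 - 3 / p, α, θ, ?_, ?_, ?_, hα0, by linarith, ?_, ?_⟩
  · exact max_lt (by linarith) (by linarith)
  · have : (s * q - θ * (p - q)) / p + 1 - 3 / p = (s * q - θ * (p - q) + p - 3) / p := by
      field_simp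
    rw [this]
    exact div_pos (by linarith) hp0
  · have : (s * q - θ * (p - q)) / p < 0 :=
      div_neg_of_neg_of_pos (by nlinarith [mul_pos hθ0 (show 0 < p - q by linarith)]) hp0
    linarith
  · field_simp
    ring
  · linarith

/-- The truncation heights `b 2^{kθ}` convert weights `2^{kx}` into `2^{ks}`. -/
theorem weight_mul_height {x r θ s q b : ℝ} (hb : 0 < b) (hq : 0 < q) (h : x + θ * r = s * q)
    (k : ℤ) (y : ℝ≥0∞) :
    ENNReal.ofReal ((2 : ℝ) ^ ((k : ℝ) * x)) *
        (ENNReal.ofReal ((b * 2 ^ ((k : ℝ) * θ)) ^ r) * y ^ q) =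
      ENNReal.ofReal (b ^ r) * (ENNReal.ofReal ((2 : ℝ) ^ ((k : ℝ) * s)) * y) ^ q := by
  rw [ENNReal.mul_rpow_of_nonneg _ _ hq.le, ENNReal.ofReal_rpow_of_pos (by positivity),
    ← mul_assoc, ← mul_assoc, ← ENNReal.ofReal_mul (by positivity),
    ← ENNReal.ofReal_mul (by positivity)]
  congr 2
  rw [Real.mul_rpow hb.le (by positivity), ← Real.rpow_mul zero_le_two, ← Real.rpow_mul zero_le_two,
    mul_left_comm, ← Real.rpow_add zero_lt_two]
  congr 2
  linear_combination (k : ℝ) * h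

theorem norm_complexify_compLp (u : L2Field) : ‖complexify.compLp u‖ = ‖u‖ := by
  refine le_antisymm ?_ ?_ <;> refine Lp.norm_le_norm_of_ae_le ?_ <;>
    filter_upwards [complexify.coeFn_compLp u] with x hx <;> rw [hx, norm_complexify]

/-- The splitting of a divergence-free field, for given exponents and truncation heights
`b 2^{kθ}`, with all constants explicit. -/
theorem exists_splitting {φ : R3 → ℝ} (hφ : IsLittlewoodPaley φ) {q s p σ α θ b : ℝ} (hq : 2 ≤ q)
    (hqp : q < p) (hα : 0 < α) (hσ : σ * p + θ * (p - q) = s * q)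
    (hαθ : 2 * α + θ * (2 - q) = s * q) (hb : 0 < b) {u₀ : L2Field} (hu₀ : IsWeaklyDivFree u₀) :
    ∃ u₁ u₂ : L2Field, IsWeaklyDivFree u₁ ∧ IsWeaklyDivFree u₂ ∧ u₀ = u₁ + u₂ ∧
      besovNorm φ σ p p u₁.toDist ^ p ≤
        (7 * ENNReal.ofReal (8 ^ |σ|) *
            (ENNReal.ofReal (invFourierL1Norm φ) * lerayKernelNorm)) ^ p *
          (ENNReal.ofReal (b ^ (p - q)) * besovNorm φ s q q u₀.toDist ^ q) ∧
      homSobolevNorm α u₂.toDist ^ (2 : ℝ) ≤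
        ENNReal.ofReal (4 * 16 ^ α) *
          (ENNReal.ofReal (b ^ (2 - q)) * besovNorm φ s q q u₀.toDist ^ q) ∧
      ‖u₁‖ ≤ 2 * ‖u₀‖ := by
  have hq0 : 0 < q := by linarith
  set v₀ : C3Field := complexify.compLp u₀ with hv₀
  have hv₀div := (isWeaklyDivFree_iff u₀).1 hu₀
  choose f hf using fun k => hφ.exists_dyadicBlock k v₀
  have hfreal : ∀ k, IsRealField (f k) := fun k =>
    hφ.isRealField_dyadicBlock (isRealField_complexify u₀) (hf k)
  have hbesov : besovNorm φ s q q u₀.toDist ^ q = ∑' k : ℤ,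
      (ENNReal.ofReal ((2 : ℝ) ^ ((k : ℝ) * s)) * eLpNorm (f k) (ENNReal.ofReal q) volume) ^ q := by
    rw [IsLittlewoodPaley.besovNorm_rpow s hq0]
    refine tsum_congr fun k => ?_
    rw [L2Field.toDist, hφ.dyadicBlock_toTemperedDistribution (hf k),
      distLpNorm_toTemperedDistribution]
  set a : ℤ → ℝ := fun k => b * 2 ^ ((k : ℝ) * θ) with ha
  have ha0 : ∀ k, 0 < a k := fun k => by positivity
  set g : ℤ → C3Field := fun k => lowPart (f k) (a k) with hg
  set h : ℤ → C3Field := fun k => highPart (f k) (a k) with hh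
  have hgsum : ∑' k, ‖g k‖ₑ ^ (2 : ℝ) ≤ ‖v₀‖ₑ ^ (2 : ℝ) := by
    refine le_trans (ENNReal.tsum_le_tsum fun k => ?_) (hφ.tsum_enorm_dyadicBlock_sq_le hf)
    exact ENNReal.rpow_le_rpow (enorm_lowPart_le _ _) zero_le_two
  have hv₀top : ‖v₀‖ₑ ^ (2 : ℝ) ≠ ⊤ := ENNReal.rpow_ne_top_of_nonneg zero_le_two enorm_ne_top
  obtain ⟨w, hw, hwn⟩ := exists_fourier_ae_eq_assemble (ne_top_of_le_ne_top hv₀top hgsum)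
  have hwreal : IsRealField w := by
    refine IsHermitian.isRealField ?_
    filter_upwards [isHermitian_assemble fun k => (hfreal k).lowPart (a k), hw, ae_comp_neg hw]
      with ξ h1 h2 h3
    rw [h2, h3]
    exact h1
  obtain ⟨u₁, hu₁⟩ := exists_complexify_eq hwreal
  have hsub : (complexify.compLp (u₀ - u₁) : C3Field) = v₀ - w := by
    rw [← hu₁]
    exact map_sub (complexify.compLpL 2 (volume : Measure R3)) u₀ u₁
  -- the Fourier transform of the remainder is assembled from the high parts
  have hrem : (𝓕 (v₀ - w) : C3Field) =ᵐ[volume] assemble h := by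
    rw [fourier_sub]
    filter_upwards [Lp.coeFn_sub (𝓕 v₀) (𝓕 w), hφ.assemble_dyadicBlock hf hv₀div, hw,
      assemble_add (f := f) (g := g) (h := h) fun k => (add_sub_cancel _ _).symm] with ξ h1 h2 h3 h4
    rw [h1, Pi.sub_apply, ← h2, h3, h4, add_sub_cancel_left]
  refine ⟨u₁, u₀ - u₁, ?_, ?_, (add_sub_cancel _ _).symm, ?_, ?_, ?_⟩
  · rw [isWeaklyDivFree_iff, hu₁]
    filter_upwards [hw] with ξ hξ
    rw [hξ, inner_assemble]
  · rw [isWeaklyDivFree_iff, hsub]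
    filter_upwards [hrem] with ξ hξ
    rw [hξ, inner_assemble]
  · rw [L2Field.toDist, hu₁]
    refine (hφ.besovNorm_assemble_rpow_le hw σ (by linarith)).trans ?_
    gcongr
    rw [hbesov, ← ENNReal.tsum_mul_left]
    refine ENNReal.tsum_le_tsum fun k => ?_
    rw [← weight_mul_height hb hq0 hσ]
    gcongr
    exact eLpNorm_lowPart_le (f k) (ha0 k) hq0 hqp.le
  · rw [L2Field.toDist, hsub]
    have h1 : homSobolevNorm α (Lp.toTemperedDistribution (v₀ - w)) ^ (2 : ℝ) ≤
        ∫⁻ ξ : R3, ‖(2 * Real.pi) • ξ‖ₑ ^ (2 * α) * ‖(𝓕 (v₀ - w) : C3Field) ξ‖ₑ ^ (2 : ℝ) := by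
      refine (ENNReal.rpow_le_rpow (homSobolevNorm_toTemperedDistribution_le α (v₀ - w))
        zero_le_two).trans (le_of_eq ?_)
      rw [← ENNReal.rpow_mul, one_div_mul_cancel two_ne_zero, ENNReal.rpow_one]
    refine h1.trans ?_
    rw [lintegral_congr_ae (hrem.mono fun ξ hξ => by rw [hξ])]
    refine (lintegral_assemble_le h hα.le).trans ?_
    gcongr
    rw [hbesov, ← ENNReal.tsum_mul_left]
    refine ENNReal.tsum_le_tsum fun k => ?_
    rw [← weight_mul_height hb hq0 hαθ]
    gcongr
    exact enorm_highPart_sq_le (f k) (ha0 k) hq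
  · rw [← norm_complexify_compLp u₁, ← norm_complexify_compLp u₀, hu₁, ← hv₀]
    have h1 : ‖w‖ₑ ^ (2 : ℝ) ≤ (2 * ‖v₀‖ₑ) ^ (2 : ℝ) := by
      refine hwn.trans ?_
      rw [ENNReal.mul_rpow_of_nonneg _ _ zero_le_two]
      refine mul_le_mul' (le_of_eq ?_) hgsum
      rw [ENNReal.rpow_two]
      norm_num
    rw [ENNReal.rpow_le_rpow_iff zero_lt_two] at h1
    have h2 := ENNReal.toReal_mono (ENNReal.mul_ne_top (by norm_num) enorm_ne_top) h1
    simpa using h2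

theorem mainTheorem4 :
    ∃ C₀ : ℝ → ℝ, ∀ q s : ℝ, 3 < q → -1 + 2 / q < s → s < 0 →
      ∃ p δ α : ℝ, max q 4 < p ∧ 0 < δ ∧ δ < 1 - 3 / p ∧ 0 < α ∧ α < 3 / 2 ∧
        ∃ C₁ : ℝ → ℝ, ∀ φ : R3 → ℝ, IsLittlewoodPaley φ →
          ∀ u₀ : L2Field, MemBesov φ s q q u₀.toDist → IsWeaklyDivFree u₀ →
            ∀ ε : ℝ, 0 < ε → ∃ u₁ u₂ : L2Field,
              IsWeaklyDivFree u₁ ∧ IsWeaklyDivFree u₂ ∧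
              MemBesov φ (-1 + 3 / p + δ) p p u₁.toDist ∧
              MemHomSobolev α u₂.toDist ∧
              u₀ = u₁ + u₂ ∧
              besovNorm φ (-1 + 3 / p + δ) p p u₁.toDist ^ p ≤
                ENNReal.ofReal (ε ^ (p - q)) * besovNorm φ s q q u₀.toDist ^ q ∧
              homSobolevNorm α u₂.toDist ^ (2 : ℝ) ≤
                ENNReal.ofReal (C₁ (invFourierL1Norm φ) * ε ^ (2 - q)) *
                  besovNorm φ s q q u₀.toDist ^ q ∧
              ‖u₁‖ ≤ C₀ (invFourierL1Norm φ) * ‖u₀‖ ∧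
              ‖u₂‖ ≤ C₀ (invFourierL1Norm φ) * ‖u₀‖ := by
  refine ⟨fun _ => 3, fun q s hq hs hs0 => ?_⟩
  obtain ⟨p, δ, α, θ, hp, hδ, hδ', hα, hα', hσ, hαθ⟩ := exists_splitting_exponents hq hs hs0
  have hqp : q < p := (le_max_left _ _).trans_lt hp
  have hp0 : 0 < p := by linarith
  set σ := -1 + 3 / p + δ with hσdef
  -- an upper bound, depending only on `‖𝓕⁻¹ φ‖_{L¹}`, for the constant of the Besov estimate
  set A : ℝ → ℝ := fun N => 7 * 8 ^ |σ| * ((|N| + 1) * (lerayKernelNorm.toReal + 1)) with hA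
  have hApos : ∀ N, 0 < A N := fun N => by positivity
  -- the factor `c` in the truncation heights absorbs the constant of the Besov estimate
  set c : ℝ → ℝ := fun N => A N ^ (-(p / (p - q))) with hc
  have hcpos : ∀ N, 0 < c N := fun N => Real.rpow_pos_of_pos (hApos N) _
  have hcA : ∀ N, A N ^ p * c N ^ (p - q) = 1 := by
    intro N
    have : -(p / (p - q)) * (p - q) = -p := by
      have : p - q ≠ 0 := by linarith
      field_simp
    rw [hc, ← Real.rpow_mul (hApos N).le, this, ← Real.rpow_add (hApos N), add_neg_cancel,
      Real.rpow_zero]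
  refine ⟨p, δ, α, hp, hδ, hδ', hα, hα', fun N => 4 * 16 ^ α * c N ^ (2 - q),
    fun φ hφ u₀ hu₀ hdiv ε hε => ?_⟩
  set N := invFourierL1Norm φ with hN
  obtain ⟨u₁, u₂, h1, h2, hsum, hB, hH, hL⟩ := exists_splitting hφ (by linarith) hqp hα hσ hαθ
    (mul_pos (hcpos N) hε) hdiv
  have hconst : 7 * ENNReal.ofReal (8 ^ |σ|) * (ENNReal.ofReal N * lerayKernelNorm) ≤
      ENNReal.ofReal (A N) := by
    rw [hA, ENNReal.ofReal_mul (by positivity), ENNReal.ofReal_mul (by norm_num),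
      ENNReal.ofReal_mul (by positivity)]
    have h7 : ENNReal.ofReal 7 = 7 := by norm_num
    rw [h7]
    gcongr
    · exact (le_abs_self N).trans (by linarith)
    · rw [← ENNReal.ofReal_toReal lerayKernelNorm_ne_top]
      exact ENNReal.ofReal_le_ofReal (by simp)
  have hB' : besovNorm φ σ p p u₁.toDist ^ p ≤
      ENNReal.ofReal (ε ^ (p - q)) * besovNorm φ s q q u₀.toDist ^ q := by
    refine hB.trans ?_
    rw [← mul_assoc]
    refine mul_le_mul' ?_ le_rfl
    calc _ ≤ ENNReal.ofReal (A N) ^ p * ENNReal.ofReal ((c N * ε) ^ (p - q)) := by gcongr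
      _ = ENNReal.ofReal (ε ^ (p - q)) := by
        rw [ENNReal.ofReal_rpow_of_pos (hApos N), ← ENNReal.ofReal_mul (by positivity),
          Real.mul_rpow (hcpos N).le hε.le, ← mul_assoc, hcA, one_mul]
  have hH' : homSobolevNorm α u₂.toDist ^ (2 : ℝ) ≤
      ENNReal.ofReal (4 * 16 ^ α * c N ^ (2 - q) * ε ^ (2 - q)) *
        besovNorm φ s q q u₀.toDist ^ q := by
    refine hH.trans (le_of_eq ?_)
    rw [← mul_assoc, ← ENNReal.ofReal_mul (by positivity), Real.mul_rpow (hcpos N).le hε.le,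
      mul_assoc (4 * 16 ^ α)]
  have hfin : besovNorm φ s q q u₀.toDist ^ q < ⊤ :=
    ENNReal.rpow_lt_top_of_nonneg (by linarith) hu₀.1.ne
  refine ⟨u₁, u₂, h1, h2, ⟨?_, hφ.hasSum_dyadicBlock _⟩, ?_, hsum, hB', hH', ?_, ?_⟩
  · exact (ENNReal.rpow_lt_top_iff_of_pos hp0).1
      (hB'.trans_lt (ENNReal.mul_lt_top ENNReal.ofReal_lt_top hfin))
  · exact (ENNReal.rpow_lt_top_iff_of_pos zero_lt_two).1
      (hH'.trans_lt (ENNReal.mul_lt_top ENNReal.ofReal_lt_top hfin))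
  · linarith [norm_nonneg u₀]
  · have h3 : u₂ = u₀ - u₁ := by rw [hsum, add_sub_cancel_left]
    rw [h3]
    linarith [norm_sub_le u₀ u₁]

end
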